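/- Let $(M,h)$ be a smooth finite-dimensional (pseudo-)Riemannian manifold, $G$ a compact Lie group with Lie algebra $\mathfrak g$ endowed with an $\mathrm{Ad}$-invariant inner product $K$, and $\pi:P\to M$ a smooth principal $G$-bundle ($G$ acting on the left) with connection form $\omega$ and curvature $\Omega=d\omega\circ\widehat H$, where $\widehat H:TP\to\ker\omega$ is the horizontal projection and $d\omega(U,V)=U(\omega(V))-V(\omega(U))-\omega([U,V])$ (so $\Omega(U,V)=-\omega([U,V])$ for horizontal fields $U,V$). Endow $P$ with the metric $\alpha=\pi^*h+K\circ\omega$, and let $\nabla^P$, $\nabla^M$ be the Levi-Civita connections of $\alpha$ and $h$. Let $\{X_i\}$ be a smooth orthonormal frame over an open set $\theta\subset M$, $h(X_i,X_j)=\varepsilon_i\delta_{ij}$ with $\varepsilon_i=\pm1$ (all $\varepsilon_i=1$ if $h$ is Riemannian), with dual coframe $\{\lambda^i\}$; let $e_i$ be the horizontal lift of $X_i$, let $\{e_\sigma\}$ be a $K$-orthonormal basis of $\mathfrak g$, put $e^i=\pi^*\lambda^i$, and define $F^\sigma_{ij}$ by $\Omega(e_i,e_j)=\sum_\sigma F^\sigma_{ij}\,e_\sigma$.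 Let $\gamma$ be a smooth curve in $P$, defined on an open set $J\subset\mathbb R$, with projection $\bar\gamma=\pi\circ\gamma$ and charge $q=\omega(\gamma')=\sum_\sigma q^\sigma e_\sigma$; over $\theta$ put $u^j=e^j(\gamma')$. 1. At every $t\in J$ with $\bar\gamma(t)\in\theta$ and for every $i$, $$e^i\big(\nabla^P_{\gamma'}\gamma'\big)=\lambda^i\big(\nabla^M_{\bar\gamma'}\bar\gamma'\big)-\varepsilon_i\sum_{j,\sigma}u^j q^\sigma F^\sigma_{ij}.$$ 2. If $\gamma$ is a geodesic of $(P,\alpha)$, then the failure of $\bar\gamma$ to be a geodesic of $(M,h)$ is exactly the Lorentz force: for every $t\in J$ and every $v\in T_{\bar\gamma(t)}M$, $$h\big(\nabla^M_{\bar\gamma'}\bar\gamma',v\big)=K\big(\Omega(\widetilde v,\widehat H\gamma'(t)),\,\omega(\gamma'(t))\big),$$ where $\widetilde v\in T_{\gamma(t)}P$ is the horizontal lift of $v$. -/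

import Mathlib

open scoped Manifold ContDiff

noncomputable section KaluzaKlein

/-! Manifolds are smooth, without boundary, modelled on a finite-dimensional real normed space `E`
through `𝓘(ℝ, E)`. In the code `pr` is the bundle projection `π : P → M` and `conn` is the
connection form `ω`. -/

section Tensors

variable {E : Type*} [NormedAddCommGroup E] [NormedSpace ℝ E]
  {M : Type*} [TopologicalSpace M] [ChartedSpace E M]

/-- The derivative, at the point `y` of the model space, of the inverse of the chart around `x₀`. -/
def chartSymmDeriv (x₀ : M) (y : E) :
    E →L[ℝ] TangentSpace 𝓘(ℝ, E) ((extChartAt 𝓘(ℝ, E) x₀).symm y) :=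
  mfderiv 𝓘(ℝ, E) 𝓘(ℝ, E) (extChartAt 𝓘(ℝ, E) x₀).symm y

/-- The expression of a field of bilinear forms in the chart around `x₀` (the metric coefficients):
its pull-back by the inverse of the chart. -/
def bilinInChart
    (g : ∀ x : M, TangentSpace 𝓘(ℝ, E) x →L[ℝ] TangentSpace 𝓘(ℝ, E) x →L[ℝ] ℝ)
    (x₀ : M) (y : E) : E →L[ℝ] E →L[ℝ] ℝ :=
  (chartSymmDeriv x₀ y).precomp ℝ ∘L g ((extChartAt 𝓘(ℝ, E) x₀).symm y) ∘L chartSymmDeriv x₀ y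

/-- The Christoffel map `Γ(u, v)` of the Levi-Civita connection of `g` at `x₀`, in the chart
around `x₀`: the vector determined by
`g(Γ(u, v), w) = (∂_u g(v, w) + ∂_v g(u, w) - ∂_w g(u, v)) / 2` for all `w`. -/
def christoffel
    (g : ∀ x : M, TangentSpace 𝓘(ℝ, E) x →L[ℝ] TangentSpace 𝓘(ℝ, E) x →L[ℝ] ℝ)
    (x₀ : M) (u v : E) : E :=
  let y₀ : E := extChartAt 𝓘(ℝ, E) x₀ x₀
  let D : E →L[ℝ] E →L[ℝ] E →L[ℝ] ℝ := fderiv ℝ (bilinInChart g x₀) y₀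
  (bilinInChart g x₀ y₀).inverse ((1 / 2 : ℝ) • (D u v + D v u - (D.flip u).flip v))

/-- The velocity `γ'(t)` of a curve. -/
def velocity (γ : ℝ → M) (t : ℝ) : TangentSpace 𝓘(ℝ, E) (γ t) :=
  mfderiv 𝓘(ℝ, ℝ) 𝓘(ℝ, E) γ t (1 : ℝ)

/-- The covariant derivative `DV/dt` at time `t` of a vector field `V` along a curve `γ`, for the
Levi-Civita connection of `g`. In the chart around `γ t`, where `V` has components `a` and the curve
is `c`, it is `a' + Γ(c', a)`. -/
def covDerivAlong
    (g : ∀ x : M, TangentSpace 𝓘(ℝ, E) x →L[ℝ] TangentSpace 𝓘(ℝ, E) x →L[ℝ] ℝ)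
    (γ : ℝ → M) (V : ∀ t, TangentSpace 𝓘(ℝ, E) (γ t)) (t : ℝ) : TangentSpace 𝓘(ℝ, E) (γ t) :=
  let φ := extChartAt 𝓘(ℝ, E) (γ t)
  let c : ℝ → E := fun s => φ (γ s)
  let a : ℝ → E := fun s => mfderiv 𝓘(ℝ, E) 𝓘(ℝ, E) φ (γ s) (V s)
  (chartSymmDeriv (γ t) (c t) (deriv a t + christoffel g (γ t) (deriv c t) (a t)) :)

/-- The acceleration `∇_{γ'} γ'` of a curve, for the Levi-Civita connection of `g`. -/
def acceleration
    (g : ∀ x : M, TangentSpace 𝓘(ℝ, E) x →L[ℝ] TangentSpace 𝓘(ℝ, E) x →L[ℝ] ℝ)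
    (γ : ℝ → M) (t : ℝ) : TangentSpace 𝓘(ℝ, E) (γ t) :=
  covDerivAlong g γ (velocity γ) t

/-- `γ` is a geodesic of `g` on the set `J` of times. -/
def IsGeodesicOn
    (g : ∀ x : M, TangentSpace 𝓘(ℝ, E) x →L[ℝ] TangentSpace 𝓘(ℝ, E) x →L[ℝ] ℝ)
    (γ : ℝ → M) (J : Set ℝ) : Prop :=
  ∀ t ∈ J, acceleration g γ t = 0

/-- The exterior derivative of a vector-valued `1`-form, computed at `x` in the chart around `x`:
`dθ(u, v) = ∂_u (θ(v)) - ∂_v (θ(u))` for constant `u`, `v`. -/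
def extDerivOne {F : Type*} [NormedAddCommGroup F] [NormedSpace ℝ F]
    (θ : ∀ x : M, TangentSpace 𝓘(ℝ, E) x →L[ℝ] F) (x : M)
    (u v : TangentSpace 𝓘(ℝ, E) x) : F :=
  let φ := extChartAt 𝓘(ℝ, E) x
  let θc : E → E →L[ℝ] F := fun y => (θ (φ.symm y)).comp (chartSymmDeriv x y)
  let u' : E := mfderiv 𝓘(ℝ, E) 𝓘(ℝ, E) φ x u
  let v' : E := mfderiv 𝓘(ℝ, E) 𝓘(ℝ, E) φ x v
  fderiv ℝ θc (φ x) u' v' - fderiv ℝ θc (φ x) v' u'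

variable (E M) in
/-- A smooth pseudo-Riemannian metric: a smooth field of symmetric nondegenerate bilinear forms. -/
structure PseudoRiemannianMetric [IsManifold 𝓘(ℝ, E) ∞ M] where
  /-- The scalar product on each tangent space. -/
  inner (x : M) : TangentSpace 𝓘(ℝ, E) x →L[ℝ] TangentSpace 𝓘(ℝ, E) x →L[ℝ] ℝ
  symm (x : M) (v w : TangentSpace 𝓘(ℝ, E) x) : inner x v w = inner x w v
  nondegenerate (x : M) (v : TangentSpace 𝓘(ℝ, E) x) (hv : ∀ w, inner x v w = 0) : v = 0
  contMDiff : ContMDiff 𝓘(ℝ, E) (𝓘(ℝ, E).prod 𝓘(ℝ, E →L[ℝ] E →L[ℝ] ℝ)) ∞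
    (fun x => Bundle.TotalSpace.mk' (E →L[ℝ] E →L[ℝ] ℝ)
      (E := fun x : M => TangentSpace 𝓘(ℝ, E) x →L[ℝ] TangentSpace 𝓘(ℝ, E) x →L[ℝ] ℝ) x (inner x))

end Tensors

section Bundles

variable {EG : Type*} [NormedAddCommGroup EG] [NormedSpace ℝ EG]
  {G : Type*} [TopologicalSpace G] [ChartedSpace EG G] [Group G]
  {EP : Type*} [NormedAddCommGroup EP] [NormedSpace ℝ EP]
  {P : Type*} [TopologicalSpace P] [ChartedSpace EP P] [MulAction G P]
  {EM : Type*} [NormedAddCommGroup EM] [NormedSpace ℝ EM]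
  {M : Type*} [TopologicalSpace M] [ChartedSpace EM M]

/-- `π : P → M` is a smooth principal bundle for the (left) action of `G` on `P`: over small open
sets it is diffeomorphic, compatibly with the projection and equivariantly, to `U × G`. In
particular the action is free and its orbits are exactly the fibres of `π`. -/
structure IsPrincipalBundle (EG : Type*) [NormedAddCommGroup EG] [NormedSpace ℝ EG]
    (G : Type*) [TopologicalSpace G] [ChartedSpace EG G] [Group G]
    (EP : Type*) [NormedAddCommGroup EP] [NormedSpace ℝ EP]
    {P : Type*} [TopologicalSpace P] [ChartedSpace EP P] [MulAction G P]
    (EM : Type*) [NormedAddCommGroup EM] [NormedSpace ℝ EM]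
    {M : Type*} [TopologicalSpace M] [ChartedSpace EM M] (pr : P → M) : Prop where
  contMDiff : ContMDiff 𝓘(ℝ, EP) 𝓘(ℝ, EM) ∞ pr
  invariant (g : G) (p : P) : pr (g • p) = pr p
  locally_trivial (x : M) : ∃ (U : Set M) (e : OpenPartialHomeomorph P (M × G)),
    IsOpen U ∧ x ∈ U ∧ e.source = pr ⁻¹' U ∧ e.target = U ×ˢ Set.univ ∧
    ContMDiffOn 𝓘(ℝ, EP) (𝓘(ℝ, EM).prod 𝓘(ℝ, EG)) ∞ e e.source ∧
    ContMDiffOn (𝓘(ℝ, EM).prod 𝓘(ℝ, EG)) 𝓘(ℝ, EP) ∞ e.symm e.target ∧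
    (∀ p ∈ e.source, (e p).1 = pr p) ∧
    (∀ (g : G), ∀ p ∈ e.source, (e (g • p)).2 = g * (e p).2)

/-- The adjoint representation: the derivative at `1` of conjugation by `g`. -/
def adjointAction (g : G) : GroupLieAlgebra 𝓘(ℝ, EG) G →L[ℝ] GroupLieAlgebra 𝓘(ℝ, EG) G :=
  (mfderiv 𝓘(ℝ, EG) 𝓘(ℝ, EG) (fun a : G => g * a * g⁻¹) 1 :)

/-- The infinitesimal action `I_p : 𝔤 → T_p P`: the derivative at `1` of `g ↦ g • p`. -/
def infinitesimalAction (p : P) :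
    GroupLieAlgebra 𝓘(ℝ, EG) G →L[ℝ] TangentSpace 𝓘(ℝ, EP) p :=
  (mfderiv 𝓘(ℝ, EG) 𝓘(ℝ, EP) (fun g : G => g • p) 1 :)

/-- A connection form on the principal bundle `P`: a smooth `𝔤`-valued `1`-form which inverts the
infinitesimal action and satisfies `g^* ω = Ad(g) ω`. -/
structure IsConnectionForm [IsManifold 𝓘(ℝ, EP) ∞ P]
    (conn : ∀ p : P, TangentSpace 𝓘(ℝ, EP) p →L[ℝ] GroupLieAlgebra 𝓘(ℝ, EG) G) : Prop where
  contMDiff : ContMDiff 𝓘(ℝ, EP) (𝓘(ℝ, EP).prod 𝓘(ℝ, EP →L[ℝ] EG)) ∞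
    (fun p => Bundle.TotalSpace.mk' (EP →L[ℝ] EG)
      (E := fun p : P => TangentSpace 𝓘(ℝ, EP) p →L[ℝ] Bundle.Trivial P EG p) p (conn p))
  infinitesimal (p : P) (ξ : GroupLieAlgebra 𝓘(ℝ, EG) G) : conn p (infinitesimalAction p ξ) = ξ
  equivariant (g : G) (p : P) (w : TangentSpace 𝓘(ℝ, EP) p) :
    conn (g • p) (mfderiv 𝓘(ℝ, EP) 𝓘(ℝ, EP) (fun q : P => g • q) p w) = adjointAction g (conn p w)

/-- `K` is an `Ad`-invariant (positive definite) inner product on the Lie algebra `𝔤` of `G`. -/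
structure IsAdInvariantInner
    (K : GroupLieAlgebra 𝓘(ℝ, EG) G →L[ℝ] GroupLieAlgebra 𝓘(ℝ, EG) G →L[ℝ] ℝ) : Prop where
  symm (ξ η : GroupLieAlgebra 𝓘(ℝ, EG) G) : K ξ η = K η ξ
  pos (ξ : GroupLieAlgebra 𝓘(ℝ, EG) G) (hξ : ξ ≠ 0) : 0 < K ξ ξ
  invariant (g : G) (ξ η : GroupLieAlgebra 𝓘(ℝ, EG) G) :
    K (adjointAction g ξ) (adjointAction g η) = K ξ η

/-- The Kaluza-Klein metric `α = π^* h + K ∘ ω` on `P`. -/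
def kaluzaKleinMetric
    (h : ∀ x : M, TangentSpace 𝓘(ℝ, EM) x →L[ℝ] TangentSpace 𝓘(ℝ, EM) x →L[ℝ] ℝ)
    (K : GroupLieAlgebra 𝓘(ℝ, EG) G →L[ℝ] GroupLieAlgebra 𝓘(ℝ, EG) G →L[ℝ] ℝ)
    (pr : P → M)
    (conn : ∀ p : P, TangentSpace 𝓘(ℝ, EP) p →L[ℝ] GroupLieAlgebra 𝓘(ℝ, EG) G) (p : P) :
    TangentSpace 𝓘(ℝ, EP) p →L[ℝ] TangentSpace 𝓘(ℝ, EP) p →L[ℝ] ℝ :=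
  (mfderiv 𝓘(ℝ, EP) 𝓘(ℝ, EM) pr p).precomp ℝ ∘L h (pr p) ∘L mfderiv 𝓘(ℝ, EP) 𝓘(ℝ, EM) pr p +
    (conn p).precomp ℝ ∘L K ∘L conn p

/-- The projection `Ĥ` of `T_p P` onto the horizontal subspace `ker ω_p`, along the vertical one. -/
def horizontalProj
    (conn : ∀ p : P, TangentSpace 𝓘(ℝ, EP) p →L[ℝ] GroupLieAlgebra 𝓘(ℝ, EG) G) (p : P)
    (w : TangentSpace 𝓘(ℝ, EP) p) : TangentSpace 𝓘(ℝ, EP) p :=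
  w - infinitesimalAction p (conn p w)

/-- The horizontal lift at `p` of a tangent vector of `M` at `π p`: the vector `w` with
`dπ w = v` and `ω w = 0`, i.e. the preimage of `(v, 0)` by the isomorphism
`(dπ, ω) : T_p P → T_{π p} M × 𝔤`. -/
def horizontalLift (pr : P → M)
    (conn : ∀ p : P, TangentSpace 𝓘(ℝ, EP) p →L[ℝ] GroupLieAlgebra 𝓘(ℝ, EG) G) (p : P)
    (v : TangentSpace 𝓘(ℝ, EM) (pr p)) : TangentSpace 𝓘(ℝ, EP) p :=
  ((mfderiv 𝓘(ℝ, EP) 𝓘(ℝ, EM) pr p).prod (conn p)).inverse (v, 0)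

/-- The curvature form `Ω = dω ∘ Ĥ` of a connection form. -/
def curvatureForm
    (conn : ∀ p : P, TangentSpace 𝓘(ℝ, EP) p →L[ℝ] GroupLieAlgebra 𝓘(ℝ, EG) G) (p : P)
    (u v : TangentSpace 𝓘(ℝ, EP) p) : GroupLieAlgebra 𝓘(ℝ, EG) G :=
  (extDerivOne (F := EG) conn p (horizontalProj conn p u) (horizontalProj conn p v) :)

/-- The Lorentz co-force `v ↦ K(Ω(ṽ, Ĥ w), ω(w))` exerted on a particle in `P` with velocity
`w ∈ T_p P`, where `ṽ` is the horizontal lift of `v`. -/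
def lorentzCoforce
    (K : GroupLieAlgebra 𝓘(ℝ, EG) G →L[ℝ] GroupLieAlgebra 𝓘(ℝ, EG) G →L[ℝ] ℝ)
    (pr : P → M)
    (conn : ∀ p : P, TangentSpace 𝓘(ℝ, EP) p →L[ℝ] GroupLieAlgebra 𝓘(ℝ, EG) G) (p : P)
    (w : TangentSpace 𝓘(ℝ, EP) p) (v : TangentSpace 𝓘(ℝ, EM) (pr p)) : ℝ :=
  K (curvatureForm conn p (horizontalLift pr conn p v) (horizontalProj conn p w)) (conn p w)

/-- The components `F^σ_{ij} = Ω^σ(e_i, e_j)` at `p` of the curvature, with respect to a basis `b`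
of `𝔤` and to the horizontal lifts `e_i` of a frame `X` of `M`. -/
def fieldStrength {ι κ : Type*} (pr : P → M)
    (conn : ∀ p : P, TangentSpace 𝓘(ℝ, EP) p →L[ℝ] GroupLieAlgebra 𝓘(ℝ, EG) G)
    (X : ι → ∀ x : M, TangentSpace 𝓘(ℝ, EM) x)
    (b : Module.Basis κ ℝ (GroupLieAlgebra 𝓘(ℝ, EG) G)) (p : P) (σ : κ) (i j : ι) : ℝ :=
  b.repr (curvatureForm conn p (horizontalLift pr conn p (X i (pr p)))
    (horizontalLift pr conn p (X j (pr p)))) σ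

end Bundles

end KaluzaKlein

/-! Lowering an index with the metric turns the acceleration of a curve $c$ in a chart into an
Euler–Lagrange expression, $g(\nabla_{c'}c',w)=g(c'',w)+\partial_{c'}g(c',w)-\tfrac12\partial_w
g(c',c')$ (`bilinInChart_acceleration`). For $\alpha=\pi^*h+K\circ\omega$ and a horizontal $w$, the
second derivatives of $\pi$ either cancel by symmetry or are absorbed into $\bar c''$ by the chain
rule. What remains is the same expression for $h$ along $\bar c$, plus $K(\omega(c'),d\omega(c',w))$
(`eulerLagrange_pullback_add_bilin`).

Equivariance of $\omega$ gives $d\omega(\text{vertical},\text{horizontal})=0$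
(`IsConnectionForm.extDerivOne_infinitesimalAction`), so $c'$ may be replaced by its horizontal part
and the extra term is minus the Lorentz co-force. If $w$ is the horizontal lift of $v$, then
$\alpha(a,w)=h(d\pi\,a,v)$. This yields the one identity behind both claims,
`inner_mfderiv_acceleration_kaluzaKleinMetric`: it holds for every smooth curve. Pairing it with the
frame gives the components, and setting the acceleration in $P$ to zero gives the geodesic
statement. -/

/-- A map into a space of continuous linear maps on a finite-dimensional space is differentiable
when its values on all vectors are. -/
theorem differentiableAt_clm_of_apply {D E F : Type*} [NormedAddCommGroup D] [NormedSpace ℝ D]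
    [NormedAddCommGroup E] [NormedSpace ℝ E] [FiniteDimensional ℝ E]
    [NormedAddCommGroup F] [NormedSpace ℝ F] {f : D → E →L[ℝ] F} {y : D}
    (h : ∀ v, DifferentiableAt ℝ (fun x => f x v) y) : DifferentiableAt ℝ f y := by
  let d := Module.finrank ℝ E
  have hd : d = Module.finrank ℝ (Fin d → ℝ) := (Module.finrank_fin_fun ℝ).symm
  let e₁ := ContinuousLinearEquiv.ofFinrankEq hd
  let e₂ := (e₁.arrowCongr (1 : F ≃L[ℝ] F)).trans (ContinuousLinearEquiv.piRing (Fin d))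
  rw [← Function.id_comp f, ← e₂.symm_comp_self]
  exact e₂.symm.differentiableAt.comp y
    (differentiableAt_pi.mpr fun i => h _)

/-! ### Calculus in normed spaces: Euler–Lagrange expressions and Cartan's formula. -/

section Calculus

variable {E E' F : Type*} [NormedAddCommGroup E] [NormedSpace ℝ E]
  [NormedAddCommGroup E'] [NormedSpace ℝ E'] [NormedAddCommGroup F] [NormedSpace ℝ F]

open Filter Topology

/-- The derivative of the sum of the pull-back by `f` of a field `H` of bilinear forms and of
`K ∘ W`, for a field `W` of linear maps. -/
theorem fderiv_pullback_add_bilin [FiniteDimensional ℝ E] {f : E → E'}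
    {H : E' → E' →L[ℝ] E' →L[ℝ] ℝ} {W : E → E →L[ℝ] F}
    {K : F →L[ℝ] F →L[ℝ] ℝ} {A : E → E →L[ℝ] E →L[ℝ] ℝ} {y : E}
    (hf : ContDiffAt ℝ 2 f y) (hH : DifferentiableAt ℝ H (f y)) (hW : DifferentiableAt ℝ W y)
    (hA : ∀ᶠ z in 𝓝 y, ∀ u v,
      A z u v = H (f z) (fderiv ℝ f z u) (fderiv ℝ f z v) + K (W z u) (W z v))
    (x u v : E) :
    fderiv ℝ A y x u v =
      fderiv ℝ H (f y) (fderiv ℝ f y x) (fderiv ℝ f y u) (fderiv ℝ f y v) +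
      H (f y) (fderiv ℝ (fderiv ℝ f) y x u) (fderiv ℝ f y v) +
      H (f y) (fderiv ℝ f y u) (fderiv ℝ (fderiv ℝ f) y x v) +
      K (fderiv ℝ W y x u) (W y v) + K (W y u) (fderiv ℝ W y x v) := by
  have hf1 : HasFDerivAt f (fderiv ℝ f y) y := (hf.differentiableAt (by norm_num)).hasFDerivAt
  have hf2 : HasFDerivAt (fderiv ℝ f) (fderiv ℝ (fderiv ℝ f) y) y :=
    ((hf.fderiv_right (m := 1) (by norm_num)).differentiableAt (by norm_num)).hasFDerivAt
  have hHf : HasFDerivAt (fun z => H (f z)) ((fderiv ℝ H (f y)).comp (fderiv ℝ f y)) y :=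
    HasFDerivAt.comp (g := H) y hH.hasFDerivAt hf1
  have hfu : ∀ u, HasFDerivAt (fun z => fderiv ℝ f z u) ((fderiv ℝ (fderiv ℝ f) y).flip u) y :=
    fun u => by simpa using hf2.clm_apply (hasFDerivAt_const u y)
  have hWu : ∀ u, HasFDerivAt (fun z => W z u) ((fderiv ℝ W y).flip u) y :=
    fun u => by simpa using hW.hasFDerivAt.clm_apply (hasFDerivAt_const u y)
  have key := fun u v => (((hHf.clm_apply (hfu u)).clm_apply (hfu v)).add
    (((K.hasFDerivAt (x := W y u)).comp y (hWu u)).clm_apply (hWu v))).congr_of_eventuallyEq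
      (hA.mono fun z hz => hz u v)
  -- Differentiability of `A` is not assumed: `hA` controls only the values `A z u v`, which
  -- determine it in finite dimension.
  have hAd : DifferentiableAt ℝ A y := differentiableAt_clm_of_apply fun u =>
    differentiableAt_clm_of_apply fun v => (key u v).differentiableAt
  have hAuv : HasFDerivAt (fun z => A z u v) (((fderiv ℝ A y).flip u).flip v) y := by
    simpa using (hAd.hasFDerivAt.clm_apply (hasFDerivAt_const u y)).clm_apply (hasFDerivAt_const v y)
  have := DFunLike.congr_fun (hAuv.unique (key u v)) x
  simp only [ContinuousLinearMap.flip_apply] at this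
  rw [this]
  simp
  ring

/-- The Euler–Lagrange expressions of a metric `H` and of `A = f^* H + K ∘ W` along a curve `c` and
its projection `c̄ = f ∘ c` differ, in a horizontal direction `w`, by the magnetic term
`K(W c', dW(c', w))`. -/
theorem eulerLagrange_pullback_add_bilin [FiniteDimensional ℝ E] {f : E → E'}
    {H : E' → E' →L[ℝ] E' →L[ℝ] ℝ}
    {W : E → E →L[ℝ] F} {K : F →L[ℝ] F →L[ℝ] ℝ} {A : E → E →L[ℝ] E →L[ℝ] ℝ}
    {c : ℝ → E} {c' : ℝ → E'} {t : ℝ}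
    (hf : ContDiffAt ℝ 2 f (c t)) (hH : DifferentiableAt ℝ H (f (c t)))
    (hW : DifferentiableAt ℝ W (c t))
    (hA : ∀ᶠ z in 𝓝 (c t), ∀ u v,
      A z u v = H (f z) (fderiv ℝ f z u) (fderiv ℝ f z v) + K (W z u) (W z v))
    (hHsymm : ∀ u v, H (f (c t)) u v = H (f (c t)) v u) (hKsymm : ∀ ξ η, K ξ η = K η ξ)
    (hc : ContDiffAt ℝ 2 c t) (hc' : c' =ᶠ[𝓝 t] f ∘ c) (w : E) (hw : W (c t) w = 0) :
    A (c t) (deriv (deriv c) t) w + fderiv ℝ A (c t) (deriv c t) (deriv c t) w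
        - (1 / 2) * fderiv ℝ A (c t) w (deriv c t) (deriv c t) =
      H (f (c t)) (deriv (deriv c') t) (fderiv ℝ f (c t) w)
        + fderiv ℝ H (f (c t)) (deriv c' t) (deriv c' t) (fderiv ℝ f (c t) w)
        - (1 / 2) * fderiv ℝ H (f (c t)) (fderiv ℝ f (c t) w) (deriv c' t) (deriv c' t)
        + K (W (c t) (deriv c t))
            (fderiv ℝ W (c t) (deriv c t) w - fderiv ℝ W (c t) w (deriv c t)) := by
  have hsymm : ∀ u v, fderiv ℝ (fderiv ℝ f) (c t) u v = fderiv ℝ (fderiv ℝ f) (c t) v u :=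
    fun u v => (hf.isSymmSndFDerivAt (by simp)).eq u v
  have hf2 : HasFDerivAt (fderiv ℝ f) (fderiv ℝ (fderiv ℝ f) (c t)) (c t) :=
    ((hf.fderiv_right (m := 1) (by norm_num)).differentiableAt (by norm_num)).hasFDerivAt
  have hcd : ∀ᶠ s in 𝓝 t, HasDerivAt c (deriv c s) s :=
    (hc.eventually (by simp)).mono fun s hs => (hs.differentiableAt (by norm_num)).hasDerivAt
  have hfd : ∀ᶠ s in 𝓝 t, HasFDerivAt f (fderiv ℝ f (c s)) (c s) :=
    hc.continuousAt.eventually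
      ((hf.eventually (by simp)).mono fun z hz => (hz.differentiableAt (by norm_num)).hasFDerivAt)
  have hd1 : deriv c' =ᶠ[𝓝 t] fun s => fderiv ℝ f (c s) (deriv c s) := by
    filter_upwards [eventually_eventually_nhds.2 hc', hcd, hfd] with s h1 h2 h3
    rw [EventuallyEq.deriv_eq h1, (h3.comp_hasDerivAt s h2).deriv]
  have hc2 : HasDerivAt (deriv c) (deriv (deriv c) t) t := by
    have : ContDiffAt ℝ 1 (deriv c) t := by
      have := hc.fderiv_right (m := 1) (by norm_num)
      exact this.clm_apply contDiffAt_const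
    exact (this.differentiableAt (by norm_num)).hasDerivAt
  have hd2 : deriv (deriv c') t = fderiv ℝ (fderiv ℝ f) (c t) (deriv c t) (deriv c t)
      + fderiv ℝ f (c t) (deriv (deriv c) t) := by
    rw [hd1.deriv_eq]
    exact ((hf2.comp_hasDerivAt t hcd.self_of_nhds).clm_apply hc2).deriv
  rw [hd2, hd1.eq_of_nhds, fderiv_pullback_add_bilin hf hH hW hA,
    fderiv_pullback_add_bilin hf hH hW hA, hA.self_of_nhds, hw]
  -- The Hessian term in `(c', c')` is the one in `deriv (deriv c')`. The two terms in `(w, c')`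
  -- cancel the one in `(c', w)`, because of the factor `1 / 2` and the symmetry of `H`. Every term
  -- containing `W w` vanishes.
  simp only [map_zero, map_add, map_sub, add_apply, hsymm w (deriv c t)]
  rw [hHsymm (fderiv ℝ (fderiv ℝ f) (c t) (deriv c t) w) _,
    hKsymm (fderiv ℝ W (c t) w (deriv c t)) _]
  ring

/-- Cartan's formula `dW(ξ, w) = 0` in a chart, for the generator `ξ` of a local action `Φ` that
preserves the condition `W w = 0`, where `W ξ` is constant. -/
theorem fderiv_sub_fderiv_eq_zero_of_action {D : Type*} [NormedAddCommGroup D] [NormedSpace ℝ D]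
    {Φ : D × E → E} {W : E → E →L[ℝ] F} {a : D} {y w : E} {ξ : D} {η : F}
    (hΦ : ContDiffAt ℝ 2 Φ (a, y)) (hW : DifferentiableAt ℝ W y)
    (hid : ∀ᶠ z in 𝓝 y, Φ (a, z) = z)
    (hinv : ∀ᶠ g in 𝓝 a, W (Φ (g, y)) (fderiv ℝ Φ (g, y) (0, w)) = 0)
    (hgen : ∀ᶠ z in 𝓝 y, W z (fderiv ℝ Φ (a, z) (ξ, 0)) = η) :
    fderiv ℝ W y (fderiv ℝ Φ (a, y) (ξ, 0)) w
      - fderiv ℝ W y w (fderiv ℝ Φ (a, y) (ξ, 0)) = 0 := by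
  have hsymm : ∀ u v, fderiv ℝ (fderiv ℝ Φ) (a, y) u v = fderiv ℝ (fderiv ℝ Φ) (a, y) v u :=
    fun u v => (hΦ.isSymmSndFDerivAt (by simp)).eq u v
  have hΦ1 : HasFDerivAt Φ (fderiv ℝ Φ (a, y)) (a, y) :=
    (hΦ.differentiableAt (by norm_num)).hasFDerivAt
  have hΦ2 : HasFDerivAt (fderiv ℝ Φ) (fderiv ℝ (fderiv ℝ Φ) (a, y)) (a, y) :=
    ((hΦ.fderiv_right (m := 1) (by norm_num)).differentiableAt (by norm_num)).hasFDerivAt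
  have hay : Φ (a, y) = y := hid.self_of_nhds
  have hl : HasFDerivAt (fun g : D => (g, y)) (ContinuousLinearMap.inl ℝ D E) a :=
    hasFDerivAt_prodMk_left a y
  have hr : HasFDerivAt (fun z : E => (a, z)) (ContinuousLinearMap.inr ℝ D E) y :=
    hasFDerivAt_prodMk_right a y
  have hw : fderiv ℝ Φ (a, y) (0, w) = w := by
    have h1 := (hΦ1.comp y hr).unique ((hasFDerivAt_id y).congr_of_eventuallyEq hid)
    simpa using DFunLike.congr_fun h1 w
  have hWΦ : HasFDerivAt (fun g => W (Φ (g, y)))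
      ((fderiv ℝ W y).comp ((fderiv ℝ Φ (a, y)).comp (ContinuousLinearMap.inl ℝ D E))) a := by
    have : HasFDerivAt W (fderiv ℝ W y) (Φ (a, y)) := by rw [hay]; exact hW.hasFDerivAt
    exact this.comp a (hΦ1.comp a hl)
  -- Differentiating `hinv` in the group direction `ξ` and `hgen` in the direction `w` produces the
  -- same mixed second derivative of `Φ`, up to symmetry; subtracting eliminates it.
  have e1 := (hWΦ.clm_apply ((hΦ2.comp a hl).clm_apply
    (hasFDerivAt_const ((0, w) : D × E) a))).unique
      ((hasFDerivAt_const (0 : F) a).congr_of_eventuallyEq hinv)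
  have e2 := (hW.hasFDerivAt.clm_apply ((hΦ2.comp y hr).clm_apply
    (hasFDerivAt_const ((ξ, 0) : D × E) y))).unique
      ((hasFDerivAt_const η y).congr_of_eventuallyEq hgen)
  have e1' := DFunLike.congr_fun e1 ξ
  have e2' := DFunLike.congr_fun e2 w
  simp [hay, hw] at e1' e2'
  rw [hsymm] at e2'
  rw [sub_eq_zero, eq_neg_of_add_eq_zero_right e1', eq_neg_of_add_eq_zero_right e2']

end Calculus

/-! ### Metrics, one-forms and accelerations in a chart. -/

section Charts

open Filter Topology Bundle

variable {E : Type*} [NormedAddCommGroup E] [NormedSpace ℝ E]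
  {M : Type*} [TopologicalSpace M] [ChartedSpace E M] [IsManifold 𝓘(ℝ, E) ∞ M]

theorem contMDiffAt_extChartAt_symm (x : M) {y : E} (hy : y ∈ (extChartAt 𝓘(ℝ, E) x).target) :
    ContMDiffAt 𝓘(ℝ, E) 𝓘(ℝ, E) ∞ (extChartAt 𝓘(ℝ, E) x).symm y :=
  (contMDiffOn_extChartAt_symm x).contMDiffAt ((isOpen_extChartAt_target x).mem_nhds hy)

theorem hasMFDerivAt_extChartAt_symm (x : M) {y : E} (hy : y ∈ (extChartAt 𝓘(ℝ, E) x).target) :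
    HasMFDerivAt 𝓘(ℝ, E) 𝓘(ℝ, E) (extChartAt 𝓘(ℝ, E) x).symm y (chartSymmDeriv x y) :=
  ((contMDiffAt_extChartAt_symm x hy).mdifferentiableAt (by simp)).hasMFDerivAt

/-- The tangent space at `x` is identified with `E` through the preferred chart at `x`, so at its
own centre that chart has identity derivative. -/
theorem chartSymmDeriv_self (x : M) :
    (chartSymmDeriv x (extChartAt 𝓘(ℝ, E) x x) : E →L[ℝ] E) = .id ℝ E := by
  have := mfderivWithin_range_extChartAt_symm (I := 𝓘(ℝ, E)) (x := x)
  rw [ModelWithCorners.range_eq_univ, mfderivWithin_univ] at this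
  exact this

/-- The coordinate vector fields of a chart are smooth. -/
theorem contMDiffAt_chartSymmDeriv (x : M) {y : E} (hy : y ∈ (extChartAt 𝓘(ℝ, E) x).target)
    (v : E) :
    ContMDiffAt 𝓘(ℝ, E) (𝓘(ℝ, E).prod 𝓘(ℝ, E)) ∞ (fun z => TotalSpace.mk' E
      (E := TangentSpace 𝓘(ℝ, E)) ((extChartAt 𝓘(ℝ, E) x).symm z) (chartSymmDeriv x z v)) y := by
  have ho := isOpen_extChartAt_target (I := 𝓘(ℝ, E)) x
  have h1 := (contMDiffOn_extChartAt_symm (I := 𝓘(ℝ, E)) (n := ∞) x).contMDiffOn_tangentMapWithin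
    (m := ∞) (by simp) ho.uniqueMDiffOn
  have h2 : ContMDiffAt 𝓘(ℝ, E) 𝓘(ℝ, E).tangent ∞
      (fun z : E => (⟨z, v⟩ : TangentBundle 𝓘(ℝ, E) E)) y :=
    contMDiffAt_vectorSpace_iff_contDiffAt.2 contDiffAt_const
  have hpre : TotalSpace.proj ⁻¹' (extChartAt 𝓘(ℝ, E) x).target ∈
      𝓝 (⟨y, v⟩ : TangentBundle 𝓘(ℝ, E) E) :=
    (ho.preimage (FiberBundle.continuous_proj E _)).mem_nhds hy
  refine ((h1.contMDiffAt hpre).comp y h2).congr_of_eventuallyEq ?_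
  filter_upwards [ho.mem_nhds hy] with z hz
  simp only [Function.comp_def, tangentMapWithin, mfderivWithin_of_isOpen ho hz]
  rfl

variable [FiniteDimensional ℝ E]

/-- The metric coefficients in a chart are differentiable. -/
theorem PseudoRiemannianMetric.differentiableAt_bilinInChart (g : PseudoRiemannianMetric E M)
    (x : M) : DifferentiableAt ℝ (bilinInChart g.inner x) (extChartAt 𝓘(ℝ, E) x x) := by
  have hy := mem_extChartAt_target (I := 𝓘(ℝ, E)) x
  refine differentiableAt_clm_of_apply fun u => differentiableAt_clm_of_apply fun v => ?_
  have : ContMDiffAt 𝓘(ℝ, E) (𝓘(ℝ, E).prod 𝓘(ℝ, ℝ)) ∞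
      (fun z => TotalSpace.mk' ℝ (E := Bundle.Trivial M ℝ) ((extChartAt 𝓘(ℝ, E) x).symm z)
        (g.inner ((extChartAt 𝓘(ℝ, E) x).symm z) (chartSymmDeriv x z u) (chartSymmDeriv x z v)))
      (extChartAt 𝓘(ℝ, E) x x) := by
    apply ContMDiffAt.clm_bundle_apply₂ (F₁ := E) (F₂ := E)
    · exact g.contMDiff.contMDiffAt.comp _ (contMDiffAt_extChartAt_symm x hy)
    · exact contMDiffAt_chartSymmDeriv x hy u
    · exact contMDiffAt_chartSymmDeriv x hy v
  simp only [contMDiffAt_totalSpace] at this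
  exact this.2.contDiffAt.differentiableAt (by simp)

/-- The expression in a chart of a smooth vector-valued `1`-form is differentiable. -/
theorem differentiableAt_oneForm_comp_chartSymmDeriv {F : Type*} [NormedAddCommGroup F]
    [NormedSpace ℝ F] {η : ∀ x : M, TangentSpace 𝓘(ℝ, E) x →L[ℝ] F}
    (hη : ContMDiff 𝓘(ℝ, E) (𝓘(ℝ, E).prod 𝓘(ℝ, E →L[ℝ] F)) ∞
      (fun x => TotalSpace.mk' (E →L[ℝ] F)
        (E := fun x : M => TangentSpace 𝓘(ℝ, E) x →L[ℝ] Bundle.Trivial M F x) x (η x))) (x : M) :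
    DifferentiableAt ℝ (fun y => ((η ((extChartAt 𝓘(ℝ, E) x).symm y)).comp (chartSymmDeriv x y) :
      E →L[ℝ] F)) (extChartAt 𝓘(ℝ, E) x x) := by
  have hy := mem_extChartAt_target (I := 𝓘(ℝ, E)) x
  refine differentiableAt_clm_of_apply fun u => ?_
  have : ContMDiffAt 𝓘(ℝ, E) (𝓘(ℝ, E).prod 𝓘(ℝ, F)) ∞
      (fun z => TotalSpace.mk' F (E := Bundle.Trivial M F) ((extChartAt 𝓘(ℝ, E) x).symm z)
        (η ((extChartAt 𝓘(ℝ, E) x).symm z) (chartSymmDeriv x z u)))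
      (extChartAt 𝓘(ℝ, E) x x) := by
    apply ContMDiffAt.clm_bundle_apply (F₁ := E) (F₂ := F)
    · exact hη.contMDiffAt.comp _ (contMDiffAt_extChartAt_symm x hy)
    · exact contMDiffAt_chartSymmDeriv x hy u
  simp only [contMDiffAt_totalSpace] at this
  exact this.2.contDiffAt.differentiableAt (by simp)

omit [FiniteDimensional ℝ E] in
theorem mfderiv_extChartAt_velocity {γ : ℝ → M} {s : ℝ} (x : M)
    (hγ : MDifferentiableAt 𝓘(ℝ, ℝ) 𝓘(ℝ, E) γ s) (hs : γ s ∈ (extChartAt 𝓘(ℝ, E) x).source) :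
    (mfderiv 𝓘(ℝ, E) 𝓘(ℝ, E) (extChartAt 𝓘(ℝ, E) x) (γ s) (velocity γ s) : E) =
      deriv (fun r => extChartAt 𝓘(ℝ, E) x (γ r)) s := by
  have h1 : MDifferentiableAt 𝓘(ℝ, E) 𝓘(ℝ, E) (extChartAt 𝓘(ℝ, E) x) (γ s) :=
    mdifferentiableAt_extChartAt (by simpa using hs)
  let A : E →L[ℝ] E := mfderiv 𝓘(ℝ, E) 𝓘(ℝ, E) (extChartAt 𝓘(ℝ, E) x) (γ s)
  let B : ℝ →L[ℝ] E := mfderiv 𝓘(ℝ, ℝ) 𝓘(ℝ, E) γ s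
  have h2 : HasFDerivAt (fun r => extChartAt 𝓘(ℝ, E) x (γ r)) (A.comp B) s :=
    (h1.hasMFDerivAt.comp s hγ.hasMFDerivAt).hasFDerivAt
  exact h2.hasDerivAt.deriv.symm

omit [FiniteDimensional ℝ E] in
theorem velocity_eq_deriv {γ : ℝ → M} {t : ℝ} (hγ : MDifferentiableAt 𝓘(ℝ, ℝ) 𝓘(ℝ, E) γ t) :
    (velocity γ t : E) = deriv (fun r => extChartAt 𝓘(ℝ, E) (γ t) (γ r)) t := by
  have := mfderiv_extChartAt_velocity (γ t) hγ (mem_extChartAt_source _)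
  rw [mfderiv_extChartAt_self] at this
  exact this

omit [FiniteDimensional ℝ E] in
/-- The acceleration of a curve in the chart around one of its points. -/
theorem acceleration_eq
    (g : ∀ x : M, TangentSpace 𝓘(ℝ, E) x →L[ℝ] TangentSpace 𝓘(ℝ, E) x →L[ℝ] ℝ)
    {γ : ℝ → M} {t : ℝ} (hγ : ∀ᶠ s in 𝓝 t, MDifferentiableAt 𝓘(ℝ, ℝ) 𝓘(ℝ, E) γ s) {c : ℝ → E}
    (hc : c = fun r => extChartAt 𝓘(ℝ, E) (γ t) (γ r)) :
    (acceleration g γ t : E) =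
      deriv (deriv c) t + christoffel g (γ t) (deriv c t) (deriv c t) := by
  subst hc
  -- Equality is needed on a neighbourhood of `t`, because the components of the velocity are
  -- differentiated once more.
  have hev : ∀ᶠ s in 𝓝 t,
      (mfderiv 𝓘(ℝ, E) 𝓘(ℝ, E) (extChartAt 𝓘(ℝ, E) (γ t)) (γ s) (velocity γ s) : E) =
        deriv (fun r => extChartAt 𝓘(ℝ, E) (γ t) (γ r)) s := by
    filter_upwards [hγ, hγ.self_of_nhds.continuousAt.preimage_mem_nhds
      (extChartAt_source_mem_nhds (I := 𝓘(ℝ, E)) (γ t))] with s h1 h2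
    exact mfderiv_extChartAt_velocity _ h1 h2
  have key : (acceleration g γ t : E) =
      (chartSymmDeriv (γ t) (extChartAt 𝓘(ℝ, E) (γ t) (γ t)) : E →L[ℝ] E)
        (deriv (fun s => (mfderiv 𝓘(ℝ, E) 𝓘(ℝ, E) (extChartAt 𝓘(ℝ, E) (γ t)) (γ s)
            (velocity γ s) : E)) t +
          christoffel g (γ t) (deriv (fun r => extChartAt 𝓘(ℝ, E) (γ t) (γ r)) t)
            (mfderiv 𝓘(ℝ, E) 𝓘(ℝ, E) (extChartAt 𝓘(ℝ, E) (γ t)) (γ t) (velocity γ t) : E)) := rfl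
  rw [key, chartSymmDeriv_self, EventuallyEq.deriv_eq hev, hev.self_of_nhds]
  rfl

/-- Nondegeneracy is injectivity into the dual, which has the same finite dimension. -/
theorem isInvertible_of_nondegenerate {V : Type*} [NormedAddCommGroup V] [NormedSpace ℝ V]
    [FiniteDimensional ℝ V] {B : V →L[ℝ] V →L[ℝ] ℝ} (hB : ∀ v, (∀ w, B v w = 0) → v = 0) :
    B.IsInvertible := by
  have hinj : Function.Injective B := by
    refine (injective_iff_map_eq_zero B).2 fun v hv => hB v fun w => by simp [hv]
  have hdim : Module.finrank ℝ V = Module.finrank ℝ (V →L[ℝ] ℝ) := by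
    rw [← LinearMap.toContinuousLinearMap.finrank_eq (R := ℝ) (M := V →ₗ[ℝ] ℝ)]
    exact (Subspace.dual_finrank_eq).symm
  exact ⟨(LinearEquiv.ofInjectiveOfFinrankEq B.toLinearMap hinj hdim).toContinuousLinearEquiv,
    by ext; rfl⟩

/-- The acceleration of a curve paired with a tangent vector, in the chart around a point. -/
theorem bilinInChart_acceleration
    (g : ∀ x : M, TangentSpace 𝓘(ℝ, E) x →L[ℝ] TangentSpace 𝓘(ℝ, E) x →L[ℝ] ℝ)
    {γ : ℝ → M} {t : ℝ} (hγ : ∀ᶠ s in 𝓝 t, MDifferentiableAt 𝓘(ℝ, ℝ) 𝓘(ℝ, E) γ s) {c : ℝ → E}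
    (hc : c = fun r => extChartAt 𝓘(ℝ, E) (γ t) (γ r))
    (hg : ∀ v, (∀ w, bilinInChart g (γ t) (c t) v w = 0) → v = 0) (w : E) :
    bilinInChart g (γ t) (c t) (acceleration g γ t : E) w =
      bilinInChart g (γ t) (c t) (deriv (deriv c) t) w
        + fderiv ℝ (bilinInChart g (γ t)) (c t) (deriv c t) (deriv c t) w
        - (1 / 2) * fderiv ℝ (bilinInChart g (γ t)) (c t) w (deriv c t) (deriv c t) := by
  rw [acceleration_eq g hγ hc, map_add, add_apply]
  have hct : extChartAt 𝓘(ℝ, E) (γ t) (γ t) = c t := by rw [hc]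
  simp only [christoffel, hct]
  -- `inverse` is `0` on non-invertible maps, so nondegeneracy is what makes the metric cancel it.
  -- With both arguments equal to `c'`, the first two Christoffel terms add up to one whole
  -- derivative.
  rw [(isInvertible_of_nondegenerate hg).self_apply_inverse]
  simp
  ring

end Charts

/-! ### Vertical vectors of a principal bundle. -/

section Bundles

open Filter Topology

variable {EG : Type*} [NormedAddCommGroup EG] [NormedSpace ℝ EG]
  {G : Type*} [TopologicalSpace G] [ChartedSpace EG G] [Group G]
  {EP : Type*} [NormedAddCommGroup EP] [NormedSpace ℝ EP]
  {P : Type*} [TopologicalSpace P] [ChartedSpace EP P] [MulAction G P]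
  {EM : Type*} [NormedAddCommGroup EM] [NormedSpace ℝ EM]
  {M : Type*} [TopologicalSpace M] [ChartedSpace EM M]

/-- A derivative at `x` is a derivative at any `x'` equal to `x`; the linear map is typed on the
model spaces, since the tangent spaces at `x` and `x'` are different types. -/
theorem HasMFDerivAt.congr_point {f : P → M} {x x' : P} {f' : EP →L[ℝ] EM}
    (hf : HasMFDerivAt 𝓘(ℝ, EP) 𝓘(ℝ, EM) f x f') (h : x = x') :
    HasMFDerivAt 𝓘(ℝ, EP) 𝓘(ℝ, EM) f x' f' := by
  subst h; exact hf

section Action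

variable (EG) in
theorem contMDiff_smul_point
    [ContMDiffSMul 𝓘(ℝ, EG) 𝓘(ℝ, EP) ∞ G P] (g : G) : ContMDiff 𝓘(ℝ, EP) 𝓘(ℝ, EP) ∞ (fun q : P => g • q) :=
  (ContMDiffSMul.contMDiff_smul (I := 𝓘(ℝ, EG)) (I' := 𝓘(ℝ, EP)) (n := ∞) (G := G)
      (M := P)).comp (contMDiff_const.prodMk contMDiff_id)

variable [ContMDiffSMul 𝓘(ℝ, EG) 𝓘(ℝ, EP) ∞ G P]

theorem hasMFDerivAt_infinitesimalAction (p : P) :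
    HasMFDerivAt 𝓘(ℝ, EG) 𝓘(ℝ, EP) (fun g : G => g • p) 1 (infinitesimalAction p) := by
  have h : ContMDiff 𝓘(ℝ, EG) 𝓘(ℝ, EP) ∞ (fun g : G => g • p) :=
    (ContMDiffSMul.contMDiff_smul (I := 𝓘(ℝ, EG)) (I' := 𝓘(ℝ, EP)) (n := ∞) (G := G)
      (M := P)).comp (contMDiff_id.prodMk contMDiff_const)
  exact (h.mdifferentiableAt (by simp)).hasMFDerivAt

namespace IsPrincipalBundle

variable {pr : P → M} (hpr : IsPrincipalBundle EG G EP EM pr)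

include hpr

omit [ContMDiffSMul 𝓘(ℝ, EG) 𝓘(ℝ, EP) ∞ G P] in
theorem hasMFDerivAt (p : P) :
    HasMFDerivAt 𝓘(ℝ, EP) 𝓘(ℝ, EM) pr p (mfderiv 𝓘(ℝ, EP) 𝓘(ℝ, EM) pr p) :=
  (hpr.contMDiff.mdifferentiableAt (by simp)).hasMFDerivAt

/-- Orbits project to a point, so the derivative of the constant map `g ↦ pr (g • p)` is zero. -/
theorem mfderiv_infinitesimalAction (p : P) (ξ : EG) :
    (mfderiv 𝓘(ℝ, EP) 𝓘(ℝ, EM) pr p (infinitesimalAction (G := G) p ξ) : EM) = 0 := by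
  have h1 : HasMFDerivAt 𝓘(ℝ, EP) 𝓘(ℝ, EM) pr ((1 : G) • p)
      (mfderiv 𝓘(ℝ, EP) 𝓘(ℝ, EM) pr p : EP →L[ℝ] EM) :=
    (hpr.hasMFDerivAt p).congr_point (one_smul G p).symm
  have h2 := h1.comp (1 : G) (hasMFDerivAt_infinitesimalAction (EG := EG) (EP := EP) p)
  have h3 : pr ∘ (fun g : G => g • p) = fun _ => pr p := funext fun g => hpr.invariant g p
  rw [h3] at h2
  exact DFunLike.congr_fun (hasMFDerivAt_unique h2 (hasMFDerivAt_const (pr p) (1 : G))) ξ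

-- A trivialization gives a local section through `p`, with constant group component `(e p).2`; its
-- derivative is a right inverse of that of `pr`.
omit [ContMDiffSMul 𝓘(ℝ, EG) 𝓘(ℝ, EP) ∞ G P] in
theorem mfderiv_surjective (p : P) (v : EM) :
    ∃ w : EP, (mfderiv 𝓘(ℝ, EP) 𝓘(ℝ, EM) pr p w : EM) = v := by
  obtain ⟨U, e, hU, hxU, hes, het, -, hesm, hfst, -⟩ := hpr.locally_trivial (pr p)
  have hp : p ∈ e.source := by rw [hes]; exact hxU
  have hep : (pr p, (e p).2) = e p := by rw [← hfst p hp]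
  have hmem : ∀ x ∈ U, (x, (e p).2) ∈ e.target := fun x hx => by rw [het]; exact ⟨hx, trivial⟩
  have h1 : MDifferentiableAt (𝓘(ℝ, EM).prod 𝓘(ℝ, EG)) 𝓘(ℝ, EP) e.symm (pr p, (e p).2) :=
    (hesm.contMDiffAt (e.open_target.mem_nhds (hmem _ hxU))).mdifferentiableAt (by simp)
  have h2 : MDifferentiableAt 𝓘(ℝ, EM) (𝓘(ℝ, EM).prod 𝓘(ℝ, EG))
      (fun x : M => (x, (e p).2)) (pr p) :=
    mdifferentiableAt_id.prodMk mdifferentiableAt_const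
  have h3 := (h1.comp (pr p) h2).hasMFDerivAt
  have hpt : p = (e.symm ∘ fun x : M => (x, (e p).2)) (pr p) := by
    simp only [Function.comp_def]; rw [hep, e.left_inv hp]
  have h4 := ((hpr.hasMFDerivAt p).congr_point hpt).comp (pr p) h3
  have h5 : (pr ∘ e.symm ∘ fun x : M => (x, (e p).2)) =ᶠ[𝓝 (pr p)] id := by
    filter_upwards [hU.mem_nhds hxU] with x hx
    have := e.map_target (hmem x hx)
    simp only [Function.comp_def, id]
    rw [← hfst _ this, e.right_inv (hmem x hx)]
  have h6 := hasMFDerivAt_unique h4 ((hasMFDerivAt_id (I := 𝓘(ℝ, EM)) (pr p)).congr_of_eventuallyEq h5)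
  exact ⟨_, DFunLike.congr_fun h6 v⟩

/-- Vertical vectors are generated by the infinitesimal action. -/
theorem exists_infinitesimalAction_eq [LieGroup 𝓘(ℝ, EG) ∞ G] (p : P) (w : EP)
    (hw : (mfderiv 𝓘(ℝ, EP) 𝓘(ℝ, EM) pr p w : EM) = 0) :
    ∃ ξ : EG, (infinitesimalAction (G := G) (EG := EG) (EP := EP) p ξ : EP) = w := by
  obtain ⟨U, e, hU, hxU, hes, het, hem, hesm, hfst, hsnd⟩ := hpr.locally_trivial (pr p)
  have hsrc : ∀ g : G, g • p ∈ e.source := fun g => by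
    rw [hes, Set.mem_preimage, hpr.invariant]; exact hxU
  have hp : p ∈ e.source := by simpa using hsrc 1
  have hep : (pr p, (e p).2) = e p := by rw [← hfst p hp]
  have he : MDifferentiableAt 𝓘(ℝ, EP) (𝓘(ℝ, EM).prod 𝓘(ℝ, EG)) e p :=
    (hem.contMDiffAt (e.open_source.mem_nhds hp)).mdifferentiableAt (by simp)
  have hes' : MDifferentiableAt (𝓘(ℝ, EM).prod 𝓘(ℝ, EG)) 𝓘(ℝ, EP) e.symm (e p) :=
    (hesm.contMDiffAt (e.open_target.mem_nhds (e.map_source hp))).mdifferentiableAt (by simp)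
  let L : EP →L[ℝ] EM × EG := mfderiv 𝓘(ℝ, EP) (𝓘(ℝ, EM).prod 𝓘(ℝ, EG)) e p
  let S : EM × EG →L[ℝ] EP := mfderiv (𝓘(ℝ, EM).prod 𝓘(ℝ, EG)) 𝓘(ℝ, EP) e.symm (e p)
  have hSL : S (L w) = w := by
    have h1 : e.symm ∘ e =ᶠ[𝓝 p] id := by
      filter_upwards [e.open_source.mem_nhds hp] with q hq using e.left_inv hq
    exact DFunLike.congr_fun (hasMFDerivAt_unique (hes'.hasMFDerivAt.comp p he.hasMFDerivAt)
      ((hasMFDerivAt_id (I := 𝓘(ℝ, EP)) p).congr_of_eventuallyEq h1)) w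
  have hL : (L w).1 = 0 := by
    have h1 : (Prod.fst ∘ e) =ᶠ[𝓝 p] pr := by
      filter_upwards [e.open_source.mem_nhds hp] with q hq using hfst q hq
    have h2 := DFunLike.congr_fun (hasMFDerivAt_unique ((hasMFDerivAt_fst (e p)).comp p he.hasMFDerivAt)
      ((hpr.hasMFDerivAt p).congr_of_eventuallyEq h1)) w
    exact Eq.trans h2 hw
  -- By equivariance, the fibre as parametrized by the trivialization is the orbit of `p`, up to the
  -- right translation that moves `(e p).2` to `1`.
  have horb : (e.symm ∘ fun g : G => (pr p, g)) =
      (fun g : G => g • p) ∘ fun g : G => g * (e p).2⁻¹ := by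
    funext g
    have h1 : e ((g * (e p).2⁻¹) • p) = (pr p, g) := by
      refine Prod.ext ?_ ?_
      · rw [hfst _ (hsrc _), hpr.invariant]
      · rw [hsnd _ _ hp]; simp
    simp only [Function.comp_def]
    rw [← h1, e.left_inv (hsrc _)]
  let A : EG →L[ℝ] EG := mfderiv 𝓘(ℝ, EG) 𝓘(ℝ, EG) (fun g : G => g * (e p).2⁻¹) (e p).2
  have hA : HasMFDerivAt 𝓘(ℝ, EG) 𝓘(ℝ, EG) (fun g : G => g * (e p).2⁻¹) (e p).2 A :=
    ((contMDiff_mul_right (I := 𝓘(ℝ, EG)) (n := ∞)).mdifferentiableAt (by simp)).hasMFDerivAt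
  have h2 : HasMFDerivAt 𝓘(ℝ, EG) 𝓘(ℝ, EP) (fun g : G => g • p) ((e p).2 * (e p).2⁻¹)
      (infinitesimalAction (G := G) (EG := EG) (EP := EP) p : EG →L[ℝ] EP) :=
    (hasMFDerivAt_infinitesimalAction p).congr_point (by simp)
  have h3 := h2.comp (e p).2 hA
  have h4 : HasMFDerivAt 𝓘(ℝ, EG) (𝓘(ℝ, EM).prod 𝓘(ℝ, EG)) (fun g : G => (pr p, g)) (e p).2
      ((0 : EG →L[ℝ] EM).prod (ContinuousLinearMap.id ℝ EG)) :=
    (hasMFDerivAt_const (pr p) (e p).2).prodMk (hasMFDerivAt_id (e p).2)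
  have h5 : HasMFDerivAt (𝓘(ℝ, EM).prod 𝓘(ℝ, EG)) 𝓘(ℝ, EP) e.symm (pr p, (e p).2) S := by
    have : ∀ z, z = e p → HasMFDerivAt (𝓘(ℝ, EM).prod 𝓘(ℝ, EG)) 𝓘(ℝ, EP) e.symm z S := by
      rintro z rfl; exact hes'.hasMFDerivAt
    exact this _ hep
  have h6 := h5.comp (e p).2 h4
  rw [horb] at h6
  have h7 := DFunLike.congr_fun (hasMFDerivAt_unique h3 h6) (L w).2
  -- A vertical `w` has only a group component in the trivialization; right translation carries it
  -- to the Lie algebra.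
  refine ⟨A (L w).2, Eq.trans h7 ?_⟩
  have h8 : ((0 : EM), (L w).2) = L w := Prod.ext hL.symm rfl
  exact (congrArg S h8).trans hSL

end IsPrincipalBundle

end Action

end Bundles

/-! ### Connection forms in charts and their exterior derivative. -/

section Connections

open Filter Topology

variable {EG : Type*} [NormedAddCommGroup EG] [NormedSpace ℝ EG]
  {G : Type*} [TopologicalSpace G] [ChartedSpace EG G] [Group G]
  {EP : Type*} [NormedAddCommGroup EP] [NormedSpace ℝ EP]
  {P : Type*} [TopologicalSpace P] [ChartedSpace EP P] [MulAction G P]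
  {EM : Type*} [NormedAddCommGroup EM] [NormedSpace ℝ EM]
  {M : Type*} [TopologicalSpace M] [ChartedSpace EM M]
  [IsManifold 𝓘(ℝ, EP) ∞ P]
  {conn : ∀ p : P, TangentSpace 𝓘(ℝ, EP) p →L[ℝ] GroupLieAlgebra 𝓘(ℝ, EG) G}

/-- The expression of a connection form in the chart around `p`. -/
noncomputable def connInChart
    (conn : ∀ p : P, TangentSpace 𝓘(ℝ, EP) p →L[ℝ] GroupLieAlgebra 𝓘(ℝ, EG) G) (p : P) (y : EP) :
    EP →L[ℝ] EG :=
  (conn ((extChartAt 𝓘(ℝ, EP) p).symm y)).comp (chartSymmDeriv p y)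

-- Tangent spaces at propositionally equal points are distinct types; typing the vector in `EP`
-- allows the base point to be changed.
omit [MulAction G P] [IsManifold 𝓘(ℝ, EP) ∞ P] in
theorem connForm_congr_point {x x' : P} (h : x = x') (u : EP) :
    (conn x u : EG) = conn x' u := by
  subst h; rfl

omit [IsManifold 𝓘(ℝ, EP) ∞ P] in
theorem infinitesimalAction_congr_point {x x' : P} (h : x = x') (ξ : EG) :
    (infinitesimalAction (G := G) (EG := EG) (EP := EP) x ξ : EP) =
      infinitesimalAction (G := G) (EG := EG) (EP := EP) x' ξ := by
  subst h; rfl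

omit [MulAction G P] in
theorem connInChart_self (p : P) (u : EP) :
    connInChart conn p (extChartAt 𝓘(ℝ, EP) p p) u = conn p u := by
  have h := DFunLike.congr_fun (chartSymmDeriv_self p) u
  have h1 := connForm_congr_point (conn := conn) (extChartAt_to_inv (I := 𝓘(ℝ, EP)) p)
    ((chartSymmDeriv p (extChartAt 𝓘(ℝ, EP) p p) : EP →L[ℝ] EP) u)
  exact h1.trans (congrArg (fun z : EP => (conn p z : EG)) h)

omit [MulAction G P] in
theorem extDerivOne_eq (p : P) (u v : EP) :
    (extDerivOne (F := EG) conn p u v : EG) =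
      fderiv ℝ (connInChart conn p) (extChartAt 𝓘(ℝ, EP) p p) u v -
        fderiv ℝ (connInChart conn p) (extChartAt 𝓘(ℝ, EP) p p) v u := by
  have h : ∀ u : EP, (mfderiv 𝓘(ℝ, EP) 𝓘(ℝ, EP) (extChartAt 𝓘(ℝ, EP) p) p u : EP) = u :=
    fun u => DFunLike.congr_fun (mfderiv_extChartAt_self (I := 𝓘(ℝ, EP)) (x := p)) u
  have : (extDerivOne (F := EG) conn p u v : EG) =
      fderiv ℝ (connInChart conn p) (extChartAt 𝓘(ℝ, EP) p p)
        (mfderiv 𝓘(ℝ, EP) 𝓘(ℝ, EP) (extChartAt 𝓘(ℝ, EP) p) p u : EP)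
        (mfderiv 𝓘(ℝ, EP) 𝓘(ℝ, EP) (extChartAt 𝓘(ℝ, EP) p) p v : EP) -
      fderiv ℝ (connInChart conn p) (extChartAt 𝓘(ℝ, EP) p p)
        (mfderiv 𝓘(ℝ, EP) 𝓘(ℝ, EP) (extChartAt 𝓘(ℝ, EP) p) p v : EP)
        (mfderiv 𝓘(ℝ, EP) 𝓘(ℝ, EP) (extChartAt 𝓘(ℝ, EP) p) p u : EP) := rfl
  rw [this, h, h]

/-- The action of `G` on `P` in the charts around `1` and around `p`. -/
noncomputable def actionInChart (EG : Type*) [NormedAddCommGroup EG] [NormedSpace ℝ EG]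
    {G : Type*} [TopologicalSpace G] [ChartedSpace EG G] [Group G] [MulAction G P]
    (p : P) (q : EG × EP) : EP :=
  extChartAt 𝓘(ℝ, EP) p
    ((extChartAt 𝓘(ℝ, EG) (1 : G)).symm q.1 • (extChartAt 𝓘(ℝ, EP) p).symm q.2)

variable [LieGroup 𝓘(ℝ, EG) ∞ G] [ContMDiffSMul 𝓘(ℝ, EG) 𝓘(ℝ, EP) ∞ G P]

theorem contMDiffAt_smul_extChartAt_symm (p : P) {q : EG × EP}
    (h1 : q.1 ∈ (extChartAt 𝓘(ℝ, EG) (1 : G)).target)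
    (h2 : q.2 ∈ (extChartAt 𝓘(ℝ, EP) p).target) :
    ContMDiffAt 𝓘(ℝ, EG × EP) 𝓘(ℝ, EP) ∞ (fun q : EG × EP =>
      (extChartAt 𝓘(ℝ, EG) (1 : G)).symm q.1 • (extChartAt 𝓘(ℝ, EP) p).symm q.2) q := by
  have i1 := (contMDiffAt_extChartAt_symm (1 : G) h1).comp q
    (contDiffAt_fst (𝕜 := ℝ) (n := ∞)).contMDiffAt
  have i2 := (contMDiffAt_extChartAt_symm p h2).comp q
    (contDiffAt_snd (𝕜 := ℝ) (n := ∞)).contMDiffAt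
  exact (ContMDiffSMul.contMDiff_smul (I := 𝓘(ℝ, EG)) (I' := 𝓘(ℝ, EP)) (n := ∞) (G := G)
    (M := P)).contMDiffAt.comp q (i1.prodMk i2)

/-- Near the base point, the action stays in the domain of the chart. -/
theorem eventually_smul_mem_source (p : P) :
    ∀ᶠ q : EG × EP in 𝓝 (extChartAt 𝓘(ℝ, EG) (1 : G) 1, extChartAt 𝓘(ℝ, EP) p p),
      q.1 ∈ (extChartAt 𝓘(ℝ, EG) (1 : G)).target ∧ q.2 ∈ (extChartAt 𝓘(ℝ, EP) p).target ∧
      (extChartAt 𝓘(ℝ, EG) (1 : G)).symm q.1 • (extChartAt 𝓘(ℝ, EP) p).symm q.2 ∈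
        (extChartAt 𝓘(ℝ, EP) p).source := by
  have h1 := extChartAt_target_mem_nhds (I := 𝓘(ℝ, EG)) (1 : G)
  have h2 := extChartAt_target_mem_nhds (I := 𝓘(ℝ, EP)) p
  have h3 := (contMDiffAt_smul_extChartAt_symm (G := G) p
    (q := (extChartAt 𝓘(ℝ, EG) (1 : G) 1, extChartAt 𝓘(ℝ, EP) p p))
    (mem_of_mem_nhds h1) (mem_of_mem_nhds h2)).continuousAt
  have h4 := extChartAt_source_mem_nhds (I := 𝓘(ℝ, EP)) p
  have h5 : (extChartAt 𝓘(ℝ, EG) (1 : G)).symm (extChartAt 𝓘(ℝ, EG) (1 : G) 1) •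
      (extChartAt 𝓘(ℝ, EP) p).symm (extChartAt 𝓘(ℝ, EP) p p) = p := by simp
  filter_upwards [continuousAt_fst.preimage_mem_nhds h1, continuousAt_snd.preimage_mem_nhds h2,
    h3.preimage_mem_nhds (by simpa only [h5] using h4)] with q a b c using ⟨a, b, c⟩

theorem contDiffAt_actionInChart (p : P) {q : EG × EP}
    (h1 : q.1 ∈ (extChartAt 𝓘(ℝ, EG) (1 : G)).target)
    (h2 : q.2 ∈ (extChartAt 𝓘(ℝ, EP) p).target)
    (h3 : (extChartAt 𝓘(ℝ, EG) (1 : G)).symm q.1 • (extChartAt 𝓘(ℝ, EP) p).symm q.2 ∈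
        (extChartAt 𝓘(ℝ, EP) p).source) :
    ContDiffAt ℝ ∞ (actionInChart (P := P) (G := G) EG p) q := by
  rw [← contMDiffAt_iff_contDiffAt]
  exact (contMDiffAt_extChartAt' (by simpa using h3)).comp q
    (contMDiffAt_smul_extChartAt_symm p h1 h2)

/-- The derivative of the action in charts, mapped back to `P`. -/
theorem eventually_hasMFDerivAt_smul (p : P) :
    ∀ᶠ q : EG × EP in 𝓝 (extChartAt 𝓘(ℝ, EG) (1 : G) 1, extChartAt 𝓘(ℝ, EP) p p),
      HasMFDerivAt 𝓘(ℝ, EG × EP) 𝓘(ℝ, EP) (fun q : EG × EP =>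
        (extChartAt 𝓘(ℝ, EG) (1 : G)).symm q.1 • (extChartAt 𝓘(ℝ, EP) p).symm q.2) q
        ((chartSymmDeriv p (actionInChart (G := G) EG p q) : EP →L[ℝ] EP).comp
          (fderiv ℝ (actionInChart (P := P) (G := G) EG p) q) : EG × EP →L[ℝ] EP) := by
  filter_upwards [eventually_eventually_nhds.2 (eventually_smul_mem_source (EG := EG) (EP := EP) (G := G) p)]
    with q hq
  obtain ⟨h1, h2, h3⟩ := hq.self_of_nhds
  have i0 : ContDiffAt ℝ ∞ (actionInChart (P := P) (G := G) EG p) q :=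
    contDiffAt_actionInChart p h1 h2 h3
  have i1 := (i0.differentiableAt (by simp)).hasFDerivAt.hasMFDerivAt
  have i2 := (hasMFDerivAt_extChartAt_symm (M := P) p
    ((extChartAt 𝓘(ℝ, EP) p).map_source h3)).comp q i1
  refine HasMFDerivAt.congr_of_eventuallyEq i2 ?_
  filter_upwards [hq] with q' hq'
  exact ((extChartAt 𝓘(ℝ, EP) p).left_inv hq'.2.2).symm

namespace IsConnectionForm

variable (hconn : IsConnectionForm conn)

include hconn

omit [LieGroup 𝓘(ℝ, EG) ∞ G] [ContMDiffSMul 𝓘(ℝ, EG) 𝓘(ℝ, EP) ∞ G P] in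
theorem differentiableAt_connInChart [FiniteDimensional ℝ EP] (p : P) :
    DifferentiableAt ℝ (connInChart conn p) (extChartAt 𝓘(ℝ, EP) p p) :=
  differentiableAt_oneForm_comp_chartSymmDeriv (F := EG) hconn.contMDiff p

/-- The exterior derivative of a connection form vanishes on a vertical and a horizontal vector. -/
theorem extDerivOne_infinitesimalAction [FiniteDimensional ℝ EP] (p : P) (ξ : EG) (w : EP)
    (hw : (conn p w : EG) = 0) :
    (extDerivOne (F := EG) conn p (infinitesimalAction (G := G) (EG := EG) (EP := EP) p ξ) w : EG)
      = 0 := by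
  set a₀ := extChartAt 𝓘(ℝ, EG) (1 : G) 1 with ha₀
  set y₀ := extChartAt 𝓘(ℝ, EP) p p with hy₀
  have ha₀' : (extChartAt 𝓘(ℝ, EG) (1 : G)).symm a₀ = 1 := extChartAt_to_inv _
  have hev := eventually_smul_mem_source (EG := EG) (EP := EP) (G := G) p
  have hder := eventually_hasMFDerivAt_smul (EG := EG) (EP := EP) (G := G) p
  have hl : Tendsto (fun a : EG => (a, y₀)) (𝓝 a₀) (𝓝 (a₀, y₀)) :=
    (continuous_id.prodMk continuous_const).tendsto _
  have hr : Tendsto (fun y : EP => (a₀, y)) (𝓝 y₀) (𝓝 (a₀, y₀)) :=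
    (continuous_const.prodMk continuous_id).tendsto _
  obtain ⟨h1, h2, h3⟩ := hev.self_of_nhds
  -- The group derivative of the action at the identity is the fundamental field of `ξ`. This is
  -- proved for all nearby `y`, since Cartan's formula differentiates `ω(ξ)` along `w`.
  have hgen' : ∀ᶠ y in 𝓝 y₀, (chartSymmDeriv p y : EP →L[ℝ] EP)
      (fderiv ℝ (actionInChart (P := P) (G := G) EG p) (a₀, y) (ξ, 0)) =
        (infinitesimalAction (G := G) (EG := EG) (EP := EP) ((extChartAt 𝓘(ℝ, EP) p).symm y) ξ
          : EP) := by
    filter_upwards [hr.eventually hev, hr.eventually hder] with y hy hd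
    have i1 : HasMFDerivAt 𝓘(ℝ, EG) 𝓘(ℝ, EG × EP) (fun a : EG => (a, y)) a₀
        (ContinuousLinearMap.inl ℝ EG EP) := (hasFDerivAt_prodMk_left a₀ y).hasMFDerivAt
    have i2 := hd.comp a₀ i1
    have i3 : HasMFDerivAt 𝓘(ℝ, EG) 𝓘(ℝ, EP)
        (fun g : G => g • (extChartAt 𝓘(ℝ, EP) p).symm y)
        ((extChartAt 𝓘(ℝ, EG) (1 : G)).symm a₀)
        (infinitesimalAction (G := G) (EG := EG) (EP := EP) ((extChartAt 𝓘(ℝ, EP) p).symm y) :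
          EG →L[ℝ] EP) := (hasMFDerivAt_infinitesimalAction _).congr_point ha₀'.symm
    have i4 := i3.comp a₀ (hasMFDerivAt_extChartAt_symm (1 : G) h1)
    have i5 := DFunLike.congr_fun (hasMFDerivAt_unique i2 i4) ξ
    have i6 : actionInChart (G := G) EG p (a₀, y) = y := by
      simp only [actionInChart, ha₀', one_smul]
      exact (extChartAt 𝓘(ℝ, EP) p).right_inv hy.2.1
    have i7 := DFunLike.congr_fun (chartSymmDeriv_self (1 : G)) ξ
    have i5' : (chartSymmDeriv p (actionInChart (G := G) EG p (a₀, y)) : EP →L[ℝ] EP)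
        (fderiv ℝ (actionInChart (P := P) (G := G) EG p) (a₀, y) (ξ, 0)) =
        (infinitesimalAction (G := G) (EG := EG) (EP := EP) ((extChartAt 𝓘(ℝ, EP) p).symm y) :
          EG →L[ℝ] EP) ((chartSymmDeriv (1 : G) a₀ : EG →L[ℝ] EG) ξ) := i5
    rw [ha₀, i7, i6] at i5'
    exact i5'
  have key := fderiv_sub_fderiv_eq_zero_of_action (Φ := actionInChart (P := P) (G := G) EG p)
    (W := connInChart conn p) (a := a₀) (y := y₀) (w := w) (ξ := ξ) (η := ξ)
    ((contDiffAt_actionInChart p h1 h2 h3).of_le ENat.LEInfty.out)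
    (hconn.differentiableAt_connInChart p) ?_ ?_ ?_
  · refine (extDerivOne_eq _ _ _).trans ?_
    have i1 : fderiv ℝ (actionInChart (P := P) (G := G) EG p) (a₀, y₀) (ξ, 0) =
        (infinitesimalAction (G := G) (EG := EG) (EP := EP) p ξ : EP) :=
      ((DFunLike.congr_fun (chartSymmDeriv_self p) _).symm.trans hgen'.self_of_nhds).trans
        (infinitesimalAction_congr_point (extChartAt_to_inv p) ξ)
    rw [i1] at key
    exact key
  · filter_upwards [extChartAt_target_mem_nhds (I := 𝓘(ℝ, EP)) p] with y hy
    simp only [actionInChart, ha₀', one_smul]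
    exact (extChartAt 𝓘(ℝ, EP) p).right_inv hy
  -- Translates of a horizontal vector stay horizontal: `ω` of the translate is `Ad(g)` applied to
  -- `ω(w) = 0`.
  · filter_upwards [hl.eventually hev, hl.eventually hder] with a ha hd
    have hy₀' : (extChartAt 𝓘(ℝ, EP) p).symm y₀ = p := extChartAt_to_inv _
    set g : G := (extChartAt 𝓘(ℝ, EG) (1 : G)).symm a with hg
    have i1 : HasMFDerivAt 𝓘(ℝ, EP) 𝓘(ℝ, EG × EP) (fun y : EP => (a, y)) y₀
        (ContinuousLinearMap.inr ℝ EG EP) := (hasFDerivAt_prodMk_right a y₀).hasMFDerivAt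
    have i2 := hd.comp y₀ i1
    have i3 : HasMFDerivAt 𝓘(ℝ, EP) 𝓘(ℝ, EP) (fun q : P => g • q)
        ((extChartAt 𝓘(ℝ, EP) p).symm y₀)
        (mfderiv 𝓘(ℝ, EP) 𝓘(ℝ, EP) (fun q : P => g • q) p : EP →L[ℝ] EP) :=
      (((contMDiff_smul_point EG g).mdifferentiableAt (by simp)).hasMFDerivAt).congr_point
        hy₀'.symm
    have i4 := i3.comp y₀ (hasMFDerivAt_extChartAt_symm p h2)
    have i5 : (chartSymmDeriv p (actionInChart (G := G) EG p (a, y₀)) : EP →L[ℝ] EP)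
        (fderiv ℝ (actionInChart (P := P) (G := G) EG p) (a, y₀) (0, w)) =
        (mfderiv 𝓘(ℝ, EP) 𝓘(ℝ, EP) (fun q : P => g • q) p : EP →L[ℝ] EP)
          ((chartSymmDeriv p y₀ : EP →L[ℝ] EP) w) :=
      DFunLike.congr_fun (hasMFDerivAt_unique i2 i4) w
    rw [hy₀, chartSymmDeriv_self] at i5
    have i6 : (extChartAt 𝓘(ℝ, EP) p).symm (actionInChart (G := G) EG p (a, y₀)) = g • p :=
      ((extChartAt 𝓘(ℝ, EP) p).left_inv ha.2.2).trans (congrArg (g • ·) hy₀')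
    have i7 : (adjointAction g (conn p w) : EG) = 0 :=
      (congrArg (fun z : EG => (adjointAction g z : EG)) hw).trans (map_zero (adjointAction g))
    have i8 := congrArg (fun z : EP => (conn (g • p) z : EG)) i5
    exact (connForm_congr_point i6 _).trans (i8.trans ((hconn.equivariant g p w).trans i7))
  · filter_upwards [hgen'] with y hy
    exact (congrArg (fun z : EP => (conn ((extChartAt 𝓘(ℝ, EP) p).symm y) z : EG)) hy).trans
      (hconn.infinitesimal _ ξ)

end IsConnectionForm

end Connections

/-! ### The Kaluza–Klein metric in charts, horizontal lifts and curvature. -/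

section KaluzaKleinCurves

open Filter Topology

section Bilin

variable {E : Type*} [NormedAddCommGroup E] [NormedSpace ℝ E]
  {M : Type*} [TopologicalSpace M] [ChartedSpace E M]
  {g : ∀ x : M, TangentSpace 𝓘(ℝ, E) x →L[ℝ] TangentSpace 𝓘(ℝ, E) x →L[ℝ] ℝ}

theorem bilin_congr_point {x x' : M} (h : x = x') (u v : E) : g x u v = g x' u v := by
  subst h; rfl

theorem bilinInChart_self [IsManifold 𝓘(ℝ, E) ∞ M] (x : M) (u v : E) :
    bilinInChart g x (extChartAt 𝓘(ℝ, E) x x) u v = g x u v := by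
  have hu := DFunLike.congr_fun (chartSymmDeriv_self x) u
  have hv := DFunLike.congr_fun (chartSymmDeriv_self x) v
  exact (bilin_congr_point (g := g) (extChartAt_to_inv (I := 𝓘(ℝ, E)) x) _ _).trans
    (congrArg₂ (fun a b : E => g x a b) hu hv)

end Bilin

variable {EG : Type*} [NormedAddCommGroup EG] [NormedSpace ℝ EG]
  {G : Type*} [TopologicalSpace G] [ChartedSpace EG G] [Group G]
  {EP : Type*} [NormedAddCommGroup EP] [NormedSpace ℝ EP]
  {P : Type*} [TopologicalSpace P] [ChartedSpace EP P] [MulAction G P]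
  {EM : Type*} [NormedAddCommGroup EM] [NormedSpace ℝ EM]
  {M : Type*} [TopologicalSpace M] [ChartedSpace EM M]
  {conn : ∀ p : P, TangentSpace 𝓘(ℝ, EP) p →L[ℝ] GroupLieAlgebra 𝓘(ℝ, EG) G}
  {pr : P → M}

theorem mfderiv_eq_fderiv_writtenInExtChartAt {p : P}
    (h : MDifferentiableAt 𝓘(ℝ, EP) 𝓘(ℝ, EM) pr p) :
    (mfderiv 𝓘(ℝ, EP) 𝓘(ℝ, EM) pr p : EP →L[ℝ] EM) =
      fderiv ℝ (writtenInExtChartAt 𝓘(ℝ, EP) 𝓘(ℝ, EM) p pr) (extChartAt 𝓘(ℝ, EP) p p) := by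
  rw [← fderivWithin_univ, ← ModelWithCorners.range_eq_univ (I := 𝓘(ℝ, EP))]
  exact h.mfderiv

section

variable [IsManifold 𝓘(ℝ, EP) ∞ P] [IsManifold 𝓘(ℝ, EM) ∞ M]

/-- A smooth map commutes with its expression in charts, and so do the derivatives. -/
theorem ContMDiff.eventually_mfderiv_chartSymmDeriv (hpr : ContMDiff 𝓘(ℝ, EP) 𝓘(ℝ, EM) ∞ pr)
    (p : P) :
    ∀ᶠ z in 𝓝 (extChartAt 𝓘(ℝ, EP) p p),
      (extChartAt 𝓘(ℝ, EM) (pr p)).symm (writtenInExtChartAt 𝓘(ℝ, EP) 𝓘(ℝ, EM) p pr z) =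
        pr ((extChartAt 𝓘(ℝ, EP) p).symm z) ∧
      ∀ u : EP, (mfderiv 𝓘(ℝ, EP) 𝓘(ℝ, EM) pr ((extChartAt 𝓘(ℝ, EP) p).symm z)
          (chartSymmDeriv p z u) : EM) =
        (chartSymmDeriv (pr p) (writtenInExtChartAt 𝓘(ℝ, EP) 𝓘(ℝ, EM) p pr z) : EM →L[ℝ] EM)
          (fderiv ℝ (writtenInExtChartAt 𝓘(ℝ, EP) 𝓘(ℝ, EM) p pr) z u) := by
  have hy := extChartAt_target_mem_nhds (I := 𝓘(ℝ, EP)) p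
  have hsrc : ∀ᶠ z in 𝓝 (extChartAt 𝓘(ℝ, EP) p p), z ∈ (extChartAt 𝓘(ℝ, EP) p).target ∧
      pr ((extChartAt 𝓘(ℝ, EP) p).symm z) ∈ (extChartAt 𝓘(ℝ, EM) (pr p)).source := by
    have h1 : ContinuousAt (fun z => pr ((extChartAt 𝓘(ℝ, EP) p).symm z))
        (extChartAt 𝓘(ℝ, EP) p p) :=
      hpr.continuous.continuousAt.comp (continuousAt_extChartAt_symm p)
    filter_upwards [hy, h1.preimage_mem_nhds (by
      simpa only [extChartAt_to_inv] using
        extChartAt_source_mem_nhds (I := 𝓘(ℝ, EM)) (pr p))] with z a b using ⟨a, b⟩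
  filter_upwards [eventually_eventually_nhds.2 hsrc] with z hz
  obtain ⟨hz1, hz2⟩ := hz.self_of_nhds
  refine ⟨(extChartAt 𝓘(ℝ, EM) (pr p)).left_inv hz2, fun u => ?_⟩
  have i1 := ((hpr.mdifferentiableAt (by simp)).hasMFDerivAt).comp z
    (hasMFDerivAt_extChartAt_symm p hz1)
  have i2 : MDifferentiableAt 𝓘(ℝ, EP) 𝓘(ℝ, EM)
      (writtenInExtChartAt 𝓘(ℝ, EP) 𝓘(ℝ, EM) p pr) z :=
    (mdifferentiableAt_extChartAt (by simpa using hz2)).comp z i1.mdifferentiableAt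
  have i3 := i2.differentiableAt.hasFDerivAt.hasMFDerivAt
  have i4 := (hasMFDerivAt_extChartAt_symm (pr p)
    ((extChartAt 𝓘(ℝ, EM) (pr p)).map_source hz2)).comp z i3
  have i5 : pr ∘ (extChartAt 𝓘(ℝ, EP) p).symm =ᶠ[𝓝 z] (extChartAt 𝓘(ℝ, EM) (pr p)).symm ∘
      writtenInExtChartAt 𝓘(ℝ, EP) 𝓘(ℝ, EM) p pr := by
    filter_upwards [hz] with z' hz'
    exact ((extChartAt 𝓘(ℝ, EM) (pr p)).left_inv hz'.2).symm
  exact DFunLike.congr_fun (hasMFDerivAt_unique i1 (i4.congr_of_eventuallyEq i5)) u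

omit [MulAction G P] in
/-- The Kaluza-Klein metric in charts. -/
theorem eventually_bilinInChart_kaluzaKleinMetric (hpr : ContMDiff 𝓘(ℝ, EP) 𝓘(ℝ, EM) ∞ pr)
    (h : ∀ x : M, TangentSpace 𝓘(ℝ, EM) x →L[ℝ] TangentSpace 𝓘(ℝ, EM) x →L[ℝ] ℝ)
    (K : GroupLieAlgebra 𝓘(ℝ, EG) G →L[ℝ] GroupLieAlgebra 𝓘(ℝ, EG) G →L[ℝ] ℝ) (p : P) :
    ∀ᶠ z in 𝓝 (extChartAt 𝓘(ℝ, EP) p p), ∀ u v,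
      bilinInChart (kaluzaKleinMetric h K pr conn) p z u v =
        bilinInChart h (pr p) (writtenInExtChartAt 𝓘(ℝ, EP) 𝓘(ℝ, EM) p pr z)
          (fderiv ℝ (writtenInExtChartAt 𝓘(ℝ, EP) 𝓘(ℝ, EM) p pr) z u)
          (fderiv ℝ (writtenInExtChartAt 𝓘(ℝ, EP) 𝓘(ℝ, EM) p pr) z v) +
        K (connInChart conn p z u) (connInChart conn p z v) := by
  filter_upwards [hpr.eventually_mfderiv_chartSymmDeriv p] with z hz u v
  have h1 := (bilin_congr_point (g := h) hz.1 _ _).trans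
    (congrArg₂ (fun a b : EM => h (pr ((extChartAt 𝓘(ℝ, EP) p).symm z)) a b)
      (hz.2 u).symm (hz.2 v).symm)
  exact congrArg (· + K (connInChart conn p z u) (connInChart conn p z v)) h1.symm

end

variable [FiniteDimensional ℝ EP] [IsManifold 𝓘(ℝ, EP) ∞ P] [LieGroup 𝓘(ℝ, EG) ∞ G]
  [ContMDiffSMul 𝓘(ℝ, EG) 𝓘(ℝ, EP) ∞ G P]

/-- `(dπ, ω)` is an isomorphism of `T_p P` onto `T_{π p} M × 𝔤`. -/
theorem IsPrincipalBundle.isInvertible_mfderiv_prod_conn (hpr : IsPrincipalBundle EG G EP EM pr)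
    (hconn : IsConnectionForm conn) (p : P) :
    ((mfderiv 𝓘(ℝ, EP) 𝓘(ℝ, EM) pr p).prod (conn p)).IsInvertible := by
  let D : EP →L[ℝ] EM := mfderiv 𝓘(ℝ, EP) 𝓘(ℝ, EM) pr p
  let C : EP →L[ℝ] EG := conn p
  let I : EG →L[ℝ] EP := infinitesimalAction (G := G) (EG := EG) (EP := EP) p
  have hDI : ∀ ξ, D (I ξ) = 0 := hpr.mfderiv_infinitesimalAction p
  have hCI : ∀ ξ, C (I ξ) = ξ := hconn.infinitesimal p
  -- The kernel of `dπ` is generated by the infinitesimal action, on which `ω` recovers the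
  -- generator.
  have hinj : Function.Injective (D.prod C) := by
    refine (injective_iff_map_eq_zero _).2 fun w hw => ?_
    have h1 : D w = 0 := congrArg Prod.fst hw
    have h2 : C w = 0 := congrArg Prod.snd hw
    obtain ⟨ξ, hξ⟩ := hpr.exists_infinitesimalAction_eq p w h1
    change I ξ = w at hξ
    rw [← hξ, hCI] at h2
    rw [← hξ, h2, map_zero]
  have hsurj : Function.Surjective (D.prod C) := by
    rintro ⟨v, ξ⟩
    obtain ⟨w, hw⟩ := hpr.mfderiv_surjective p v
    change D w = v at hw
    -- A vertical correction adjusts the value of `ω` to `ξ` and leaves `dπ` unchanged.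
    refine ⟨w + I (ξ - C w), Prod.ext ?_ ?_⟩
    · change D (w + I (ξ - C w)) = v
      rw [map_add, hDI, hw, add_zero]
    · change C (w + I (ξ - C w)) = ξ
      rw [map_add, hCI, add_sub_cancel]
  have : FiniteDimensional ℝ (EM × EG) :=
    Module.Finite.of_surjective (D.prod C).toLinearMap hsurj
  exact ⟨(LinearEquiv.ofBijective (D.prod C).toLinearMap ⟨hinj, hsurj⟩).toContinuousLinearEquiv,
    rfl⟩

section HorizontalLift

variable (hpr : IsPrincipalBundle EG G EP EM pr) (hconn : IsConnectionForm conn) (p : P)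

include hpr hconn

theorem mfderiv_horizontalLift (v : EM) :
    (mfderiv 𝓘(ℝ, EP) 𝓘(ℝ, EM) pr p (horizontalLift pr conn p v) : EM) = v :=
  congrArg Prod.fst ((hpr.isInvertible_mfderiv_prod_conn hconn p).self_apply_inverse (v, 0))

theorem conn_horizontalLift (v : EM) : (conn p (horizontalLift pr conn p v) : EG) = 0 :=
  congrArg Prod.snd ((hpr.isInvertible_mfderiv_prod_conn hconn p).self_apply_inverse (v, 0))

theorem eq_of_mfderiv_eq_of_conn_eq {u w : EP}
    (h1 : (mfderiv 𝓘(ℝ, EP) 𝓘(ℝ, EM) pr p u : EM) = mfderiv 𝓘(ℝ, EP) 𝓘(ℝ, EM) pr p w)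
    (h2 : (conn p u : EG) = conn p w) : u = w :=
  (hpr.isInvertible_mfderiv_prod_conn hconn p).injective (Prod.ext h1 h2)

/-- Both sides have the same image under `dπ` and are killed by `ω`, and these data determine a
tangent vector. -/
theorem horizontalProj_eq_horizontalLift (w : EP) :
    (horizontalProj conn p w : EP) =
      horizontalLift pr conn p (mfderiv 𝓘(ℝ, EP) 𝓘(ℝ, EM) pr p w) := by
  apply eq_of_mfderiv_eq_of_conn_eq hpr hconn p
  · refine Eq.trans ?_ (mfderiv_horizontalLift hpr hconn p _).symm
    refine (map_sub (mfderiv 𝓘(ℝ, EP) 𝓘(ℝ, EM) pr p) w _).trans ?_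
    exact (congrArg (fun z : EM =>
      (show EM from mfderiv 𝓘(ℝ, EP) 𝓘(ℝ, EM) pr p w) - z)
      (hpr.mfderiv_infinitesimalAction p _)).trans (sub_zero _)
  · refine Eq.trans ?_ (conn_horizontalLift hpr hconn p _).symm
    refine (map_sub (conn p) w _).trans ?_
    exact (congrArg (fun z : EG => (show EG from conn p w) - z) (hconn.infinitesimal p _)).trans
      (sub_self _)

omit [FiniteDimensional ℝ EP] [IsManifold 𝓘(ℝ, EP) ∞ P] [LieGroup 𝓘(ℝ, EG) ∞ G]
  [ContMDiffSMul 𝓘(ℝ, EG) 𝓘(ℝ, EP) ∞ G P] hpr hconn in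
theorem horizontalProj_of_conn_eq_zero {w : EP} (hw : (conn p w : EG) = 0) :
    (horizontalProj conn p w : EP) = w := by
  have : (infinitesimalAction (G := G) (EG := EG) (EP := EP) p (conn p w) : EP) = 0 :=
    (congrArg (fun z : EG => (infinitesimalAction (G := G) (EG := EG) (EP := EP) p z : EP)) hw).trans
      (map_zero (infinitesimalAction (G := G) (EG := EG) (EP := EP) p))
  exact (congrArg (fun z : EP => w - z) this).trans (sub_zero w)

/-- On a horizontal vector and the horizontal part of a vector, the curvature is `dω`. -/
theorem curvatureForm_horizontalProj {u : EP} (hu : (conn p u : EG) = 0) (w : EP) :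
    (curvatureForm conn p u (horizontalProj conn p w) : EG) =
      fderiv ℝ (connInChart conn p) (extChartAt 𝓘(ℝ, EP) p p) u w -
        fderiv ℝ (connInChart conn p) (extChartAt 𝓘(ℝ, EP) p p) w u := by
  have h1 : (conn p (horizontalProj conn p w) : EG) = 0 := by
    have := horizontalProj_eq_horizontalLift hpr hconn p w
    exact (congrArg (fun z : EP => (conn p z : EG)) this).trans
      (conn_horizontalLift hpr hconn p _)
  have h2 : (curvatureForm conn p u (horizontalProj conn p w) : EG) =
      (extDerivOne (F := EG) conn p u (horizontalProj conn p w) : EG) :=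
    congrArg₂ (fun a b : EP => (extDerivOne (F := EG) conn p a b : EG))
      (horizontalProj_of_conn_eq_zero p hu) (horizontalProj_of_conn_eq_zero p h1)
  -- `I` is the vertical part of `w`. Since `dω(I, u) = 0` for horizontal `u`, the projection of the
  -- second argument can be dropped.
  let I : EP := infinitesimalAction (G := G) (EG := EG) (EP := EP) p (conn p w)
  have h3 := (extDerivOne_eq (conn := conn) p I u).symm.trans
    (hconn.extDerivOne_infinitesimalAction p (conn p w) u hu)
  have h4 : (horizontalProj conn p w : EP) =
      w - I := rfl
  rw [h2]
  refine (extDerivOne_eq (conn := conn) p _ _).trans ?_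
  rw [h4]
  simp only [map_sub, sub_apply]
  rw [sub_eq_zero] at h3
  rw [h3]
  abel

end HorizontalLift

end KaluzaKleinCurves

/-! ### Comparison of the accelerations in `P` and in `M`. -/

section Wong

open Filter Topology

variable {EG : Type*} [NormedAddCommGroup EG] [NormedSpace ℝ EG]
  {G : Type*} [TopologicalSpace G] [ChartedSpace EG G] [Group G] [LieGroup 𝓘(ℝ, EG) ∞ G]
  {EP : Type*} [NormedAddCommGroup EP] [NormedSpace ℝ EP] [FiniteDimensional ℝ EP]
  {P : Type*} [TopologicalSpace P] [ChartedSpace EP P] [IsManifold 𝓘(ℝ, EP) ∞ P]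
  [MulAction G P] [ContMDiffSMul 𝓘(ℝ, EG) 𝓘(ℝ, EP) ∞ G P]
  {EM : Type*} [NormedAddCommGroup EM] [NormedSpace ℝ EM] [FiniteDimensional ℝ EM]
  {M : Type*} [TopologicalSpace M] [ChartedSpace EM M] [IsManifold 𝓘(ℝ, EM) ∞ M]
  {pr : P → M} (hpr : IsPrincipalBundle EG G EP EM pr) (h : PseudoRiemannianMetric EM M)
  {conn : ∀ p : P, TangentSpace 𝓘(ℝ, EP) p →L[ℝ] GroupLieAlgebra 𝓘(ℝ, EG) G}
  (hconn : IsConnectionForm conn)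
  {K : GroupLieAlgebra 𝓘(ℝ, EG) G →L[ℝ] GroupLieAlgebra 𝓘(ℝ, EG) G →L[ℝ] ℝ}
  (hK : IsAdInvariantInner K)

include hpr hconn hK

-- Since `(dπ, ω)` is onto, vectors over `(m, 0)` can be used as tests and nondegeneracy of `h`
-- gives `dπ v = 0`. Then `K(ω v, ω v) = 0`, and positivity of `K` finishes.
omit [FiniteDimensional ℝ EM] in
theorem kaluzaKleinMetric_nondegenerate (p : P) (v : EP)
    (hv : ∀ w : EP, kaluzaKleinMetric h.inner K pr conn p v w = 0) : v = 0 := by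
  let D : EP →L[ℝ] EM := mfderiv 𝓘(ℝ, EP) 𝓘(ℝ, EM) pr p
  let C : EP →L[ℝ] EG := conn p
  let H : EM →L[ℝ] EM →L[ℝ] ℝ := h.inner (pr p)
  let K' : EG →L[ℝ] EG →L[ℝ] ℝ := K
  have hv' : ∀ w : EP, H (D v) (D w) + K' (C v) (C w) = 0 := hv
  have hsurj : ∀ z : EM × EG, ∃ w : EP, (D w, C w) = z :=
    (hpr.isInvertible_mfderiv_prod_conn hconn p).surjective
  have hD : D v = 0 := h.nondegenerate (pr p) (D v) fun m => by
    obtain ⟨w, hw⟩ := hsurj (m, 0)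
    have := hv' w
    have h1 : D w = m := congrArg Prod.fst hw
    have h2 : C w = 0 := congrArg Prod.snd hw
    rw [h1, h2, map_zero, add_zero] at this
    exact this
  have hC : C v = 0 := by
    by_contra hne
    have := hv' v
    rw [hD, map_zero] at this
    exact (hK.pos (C v) hne).ne' ((zero_add _).symm.trans this)
  refine eq_of_mfderiv_eq_of_conn_eq hpr hconn p (u := v) (w := (0 : EP)) ?_ ?_
  · exact hD.trans (map_zero D).symm
  · exact hC.trans (map_zero C).symm

/-- The projection of the acceleration of a curve in `P` differs from the acceleration of the
projected curve by the Lorentz force. -/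
theorem inner_mfderiv_acceleration_kaluzaKleinMetric {γ : ℝ → P} {J : Set ℝ} (hJ : IsOpen J)
    (hγ : ContMDiffOn 𝓘(ℝ, ℝ) 𝓘(ℝ, EP) ∞ γ J) {t : ℝ} (ht : t ∈ J) (v : EM) :
    h.inner (pr (γ t)) (mfderiv 𝓘(ℝ, EP) 𝓘(ℝ, EM) pr (γ t)
        (acceleration (kaluzaKleinMetric h.inner K pr conn) γ t)) v =
      h.inner (pr (γ t)) (acceleration h.inner (fun s => pr (γ s)) t) v -
        lorentzCoforce K pr conn (γ t) (velocity γ t) v := by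
  set p := γ t with hp
  let c : ℝ → EP := fun r => extChartAt 𝓘(ℝ, EP) p (γ r)
  let c' : ℝ → EM := fun r => extChartAt 𝓘(ℝ, EM) (pr p) (pr (γ r))
  let f : EP → EM := writtenInExtChartAt 𝓘(ℝ, EP) 𝓘(ℝ, EM) p pr
  let D : EP →L[ℝ] EM := mfderiv 𝓘(ℝ, EP) 𝓘(ℝ, EM) pr p
  let C : EP →L[ℝ] EG := conn p
  let H : EM →L[ℝ] EM →L[ℝ] ℝ := h.inner (pr p)
  let K' : EG →L[ℝ] EG →L[ℝ] ℝ := K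
  let w : EP := horizontalLift pr conn p v
  let u : EP := velocity γ t
  let a : EP := acceleration (kaluzaKleinMetric h.inner K pr conn) γ t
  let b : EM := acceleration h.inner (fun s => pr (γ s)) t
  have hct : c t = extChartAt 𝓘(ℝ, EP) p p := rfl
  have hfct : f (c t) = extChartAt 𝓘(ℝ, EM) (pr p) (pr p) := by
    simp only [f, hct, writtenInExtChartAt, Function.comp_def, extChartAt_to_inv]
  have hγt : ContMDiffAt 𝓘(ℝ, ℝ) 𝓘(ℝ, EP) ∞ γ t := hγ.contMDiffAt (hJ.mem_nhds ht)
  have hγd : ∀ᶠ s in 𝓝 t, MDifferentiableAt 𝓘(ℝ, ℝ) 𝓘(ℝ, EP) γ s := by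
    filter_upwards [hJ.mem_nhds ht] with s hs
    exact (hγ.contMDiffAt (hJ.mem_nhds hs)).mdifferentiableAt (by simp)
  have hγd' : ∀ᶠ s in 𝓝 t, MDifferentiableAt 𝓘(ℝ, ℝ) 𝓘(ℝ, EM) (fun r => pr (γ r)) s := by
    filter_upwards [hγd] with s hs
    exact (hpr.contMDiff.mdifferentiableAt (by simp)).comp s hs
  have hprd : MDifferentiableAt 𝓘(ℝ, EP) 𝓘(ℝ, EM) pr p := hpr.contMDiff.mdifferentiableAt (by simp)
  have hD : fderiv ℝ f (c t) = D := (mfderiv_eq_fderiv_writtenInExtChartAt hprd).symm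
  have hf : ContDiffAt ℝ 2 f (c t) := by
    have := (contMDiffAt_iff.1 (hpr.contMDiff.contMDiffAt (x := p))).2
    rw [ModelWithCorners.range_eq_univ, contDiffWithinAt_univ] at this
    exact this.of_le ENat.LEInfty.out
  have hc : ContDiffAt ℝ 2 c t := by
    have := ((contMDiffAt_extChartAt (I := 𝓘(ℝ, EP)) (n := ∞) (x := p)).comp t hγt).contDiffAt
    exact this.of_le ENat.LEInfty.out
  have hcc : c' =ᶠ[𝓝 t] f ∘ c := by
    filter_upwards [hγt.continuousAt.preimage_mem_nhds
      (extChartAt_source_mem_nhds (I := 𝓘(ℝ, EP)) (γ t))] with s hs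
    simp only [c', f, c, Function.comp_def, writtenInExtChartAt]
    rw [(extChartAt 𝓘(ℝ, EP) p).left_inv hs]
  have hu : deriv c t = u := (velocity_eq_deriv hγd.self_of_nhds).symm
  have hA := eventually_bilinInChart_kaluzaKleinMetric (conn := conn) hpr.contMDiff h.inner K p
  have hdH : DifferentiableAt ℝ (bilinInChart h.inner (pr p)) (f (c t)) := by
    rw [hfct]; exact h.differentiableAt_bilinInChart (pr p)
  have hHself : ∀ m n : EM, bilinInChart h.inner (pr p) (f (c t)) m n = H m n := fun m n => by
    rw [hfct]; exact bilinInChart_self (pr p) m n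
  have hAself : ∀ m n : EP, bilinInChart (kaluzaKleinMetric h.inner K pr conn) p (c t) m n =
      H (D m) (D n) + K' (C m) (C n) := fun m n => bilinInChart_self p m n
  have hWself : ∀ m : EP, connInChart conn p (c t) m = C m := connInChart_self p
  have hCw : C w = 0 := conn_horizontalLift hpr hconn p v
  have hDw : D w = v := mfderiv_horizontalLift hpr hconn p v
  have key := eulerLagrange_pullback_add_bilin (K := K') (c' := c') hf hdH
    (hconn.differentiableAt_connInChart p) hA
    (fun m n => by rw [hHself, hHself]; exact h.symm (pr p) m n) hK.symm hc hcc w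
    ((hWself w).trans hCw)
  have hP := bilinInChart_acceleration (kaluzaKleinMetric h.inner K pr conn) hγd (c := c) rfl
    (fun v hv => kaluzaKleinMetric_nondegenerate hpr h hconn hK p v fun w =>
      (bilinInChart_self p v w).symm.trans (hv w)) w
  have hM := bilinInChart_acceleration h.inner hγd' (c := c') rfl
    (fun v hv => h.nondegenerate (pr p) v fun w =>
      (bilinInChart_self (pr p) v w).symm.trans (hv w)) v
  have hM' : H b v = _ := (bilinInChart_self (pr p) b v).symm.trans hM
  have hP' : H (D a) (D w) + K' (C a) (C w) = _ := (hAself a w).symm.trans hP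
  have hc't : c' t = f (c t) := hfct.symm
  have hcurv := curvatureForm_horizontalProj hpr hconn p hCw u
  have hL : lorentzCoforce K pr conn p u v =
      K' (fderiv ℝ (connInChart conn p) (c t) w u - fderiv ℝ (connInChart conn p) (c t) u w)
        (C u) := congrArg (fun z : EG => K' z (C u)) hcurv
  -- Against the horizontal lift `w` of `v`, the `K`-part of the metric disappears and the `h`-part
  -- becomes a pairing with `v`.
  rw [hCw, map_zero, add_zero, hDw] at hP'
  rw [hD, hDw, hWself, hu] at key
  rw [hc't] at hM'
  -- The magnetic term has `dω(u, w)` and the co-force has `dω(w, u)`; antisymmetry accounts for the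
  -- minus sign in the statement.
  have hsymm : K' (fderiv ℝ (connInChart conn p) (c t) w u -
      fderiv ℝ (connInChart conn p) (c t) u w) (C u) = - K' (C u)
        (fderiv ℝ (connInChart conn p) (c t) u w - fderiv ℝ (connInChart conn p) (c t) w u) := by
    rw [← map_neg, neg_sub]
    exact hK.symm _ _
  change H (D a) v = H b v - lorentzCoforce K pr conn p u v
  rw [hL, hsymm, hM', hP', hu, key]
  ring

end Wong

/-! ### Components in orthonormal frames, and the theorem. -/

/-- A bilinear form in a basis in which it is diagonal. -/
theorem bilin_eq_sum_of_orthogonal {κ V : Type*} [Fintype κ] [AddCommGroup V] [Module ℝ V]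
    (K : V →ₗ[ℝ] V →ₗ[ℝ] ℝ) (b : Module.Basis κ ℝ V) (ε : κ → ℝ) (hdiag : ∀ σ, K (b σ) (b σ) = ε σ)
    (hoff : ∀ σ τ, σ ≠ τ → K (b σ) (b τ) = 0) (ξ η : V) :
    K ξ η = ∑ σ, ε σ * (b.repr ξ σ * b.repr η σ) := by
  have h : ∀ σ, K (b σ) η = b.repr η σ * ε σ := fun σ => by
    conv_lhs => rw [← b.sum_repr η]
    rw [map_sum, Finset.sum_eq_single σ]
    · rw [map_smul, hdiag, smul_eq_mul]
    · intro τ _ hτ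
      rw [map_smul, hoff σ τ hτ.symm, smul_zero]
    · intro hσ
      exact absurd (Finset.mem_univ σ) hσ
  conv_lhs => rw [← b.sum_repr ξ]
  rw [map_sum, LinearMap.sum_apply]
  refine Finset.sum_congr rfl fun σ _ => ?_
  rw [map_smul, LinearMap.smul_apply, h, smul_eq_mul]
  ring

section LorentzForce

variable {EG : Type*} [NormedAddCommGroup EG] [NormedSpace ℝ EG]
  {G : Type*} [TopologicalSpace G] [ChartedSpace EG G] [Group G] [LieGroup 𝓘(ℝ, EG) ∞ G]
  {EP : Type*} [NormedAddCommGroup EP] [NormedSpace ℝ EP] [FiniteDimensional ℝ EP]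
  {P : Type*} [TopologicalSpace P] [ChartedSpace EP P] [IsManifold 𝓘(ℝ, EP) ∞ P]
  [MulAction G P] [ContMDiffSMul 𝓘(ℝ, EG) 𝓘(ℝ, EP) ∞ G P]
  {EM : Type*} [NormedAddCommGroup EM] [NormedSpace ℝ EM]
  {M : Type*} [TopologicalSpace M] [ChartedSpace EM M]
  {pr : P → M}
  {conn : ∀ p : P, TangentSpace 𝓘(ℝ, EP) p →L[ℝ] GroupLieAlgebra 𝓘(ℝ, EG) G}

/-- The curvature is linear in the base vector whose horizontal lift it is evaluated on. -/
theorem exists_linearMap_eq_curvatureForm (hpr : IsPrincipalBundle EG G EP EM pr)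
    (hconn : IsConnectionForm conn) (p : P) {u : EP} (hu : (conn p u : EG) = 0) :
    ∃ T : EM →ₗ[ℝ] EG, ∀ m : EM,
      (curvatureForm conn p u (horizontalLift pr conn p m) : EG) = T m := by
  let L : EM →L[ℝ] EP := ((mfderiv 𝓘(ℝ, EP) 𝓘(ℝ, EM) pr p).prod (conn p)).inverse.comp
    (ContinuousLinearMap.inl ℝ EM EG)
  let y := extChartAt 𝓘(ℝ, EP) p p
  let A : EP →L[ℝ] EG :=
    fderiv ℝ (connInChart conn p) y u - (fderiv ℝ (connInChart conn p) y).flip u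
  refine ⟨(A.comp L).toLinearMap, fun m => ?_⟩
  -- A lift equals its own horizontal projection, so the curvature formula applies to it, and that
  -- formula is visibly linear in `L m`.
  have h1 : (horizontalProj conn p (L m) : EP) = L m :=
    horizontalProj_of_conn_eq_zero p (conn_horizontalLift hpr hconn p m)
  exact (congrArg (fun z : EP => (curvatureForm conn p u z : EG)) h1.symm).trans
    (curvatureForm_horizontalProj hpr hconn p hu (L m))

/-- The Lorentz co-force in terms of the components of the curvature. -/
theorem lorentzCoforce_eq_sum (hpr : IsPrincipalBundle EG G EP EM pr)
    (hconn : IsConnectionForm conn)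
    (K : GroupLieAlgebra 𝓘(ℝ, EG) G →L[ℝ] GroupLieAlgebra 𝓘(ℝ, EG) G →L[ℝ] ℝ)
    {ι κ : Type*} [Fintype ι] [Fintype κ] {X : ι → ∀ x : M, TangentSpace 𝓘(ℝ, EM) x}
    (b : Module.Basis κ ℝ (GroupLieAlgebra 𝓘(ℝ, EG) G))
    (hbdiag : ∀ σ, K (b σ) (b σ) = 1) (hboff : ∀ σ τ, σ ≠ τ → K (b σ) (b τ) = 0)
    (p : P) (w : EP) (a : ι → ℝ)
    (hw : (mfderiv 𝓘(ℝ, EP) 𝓘(ℝ, EM) pr p w) = ∑ j, a j • X j (pr p)) (i : ι) :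
    lorentzCoforce K pr conn p w (X i (pr p)) =
      ∑ j, ∑ σ, a j * b.repr (conn p w) σ * fieldStrength pr conn X b p σ i j := by
  obtain ⟨T, hT⟩ := exists_linearMap_eq_curvatureForm hpr hconn p
    (conn_horizontalLift hpr hconn p (X i (pr p)))
  let Y : ι → EM := fun j => X j (pr p)
  let b' : Module.Basis κ ℝ EG := b
  let K' : EG →L[ℝ] EG →L[ℝ] ℝ := K
  let q : EG := conn p w
  have hΩ : (curvatureForm conn p (horizontalLift pr conn p (X i (pr p)))
      (horizontalProj conn p w) : EG) = ∑ j, a j • T (Y j) := by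
    -- The horizontal part of `w` is the lift of `dπ w`, whose expansion in the frame passes through
    -- the linear map `T`.
    refine (congrArg (fun z : EP => (curvatureForm conn p
      (horizontalLift pr conn p (X i (pr p))) z : EG))
      (horizontalProj_eq_horizontalLift hpr hconn p w)).trans ((hT _).trans ?_)
    refine (congrArg T hw).trans ?_
    change T (∑ j, a j • Y j) = _
    rw [map_sum]
    exact Finset.sum_congr rfl fun j _ => map_smul T (a j) (Y j)
  have hF : ∀ σ j, fieldStrength pr conn X b p σ i j = b'.repr (T (Y j)) σ := fun σ j =>
    congrArg (fun z : EG => b'.repr z σ) (hT (Y j))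
  have hK' := bilin_eq_sum_of_orthogonal K'.toLinearMap₁₂ b' (fun _ => 1) hbdiag hboff
  have h1 : lorentzCoforce K pr conn p w (X i (pr p)) = K' (∑ j, a j • T (Y j)) q :=
    congrArg (fun z : EG => K' z q) hΩ
  rw [h1]
  refine (hK' _ _).trans ?_
  change ∑ σ, 1 * (b'.repr (∑ j, a j • T (Y j)) σ * b'.repr q σ) =
    ∑ j, ∑ σ, a j * b'.repr q σ * fieldStrength pr conn X b p σ i j
  rw [Finset.sum_comm]
  refine Finset.sum_congr rfl fun σ _ => ?_
  simp only [hF, map_sum, map_smul, Finsupp.coe_finsetSum, Finset.sum_apply, Finsupp.smul_apply,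
    smul_eq_mul, Finset.sum_mul, one_mul]
  exact Finset.sum_congr rfl fun j _ => by ring

end LorentzForce

/-- The coefficients of a vector in an orthonormal frame. -/
theorem coeff_eq_of_orthonormal {EM : Type*} [NormedAddCommGroup EM] [NormedSpace ℝ EM]
    {M : Type*} [TopologicalSpace M] [ChartedSpace EM M] [IsManifold 𝓘(ℝ, EM) ∞ M]
    (h : ∀ x : M, TangentSpace 𝓘(ℝ, EM) x →L[ℝ] TangentSpace 𝓘(ℝ, EM) x →L[ℝ] ℝ)
    {ι : Type*} [Fintype ι] {θ : Set M} {X : ι → ∀ x : M, TangentSpace 𝓘(ℝ, EM) x}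
    (hX : IsLocalFrameOn 𝓘(ℝ, EM) EM ∞ X θ)
    {ε : ι → ℝ} (hε : ∀ i, ε i = 1 ∨ ε i = -1)
    (hXdiag : ∀ x ∈ θ, ∀ i, h x (X i x) (X i x) = ε i)
    (hXoff : ∀ x ∈ θ, ∀ i j, i ≠ j → h x (X i x) (X j x) = 0)
    {x : M} (hx : x ∈ θ) (v : TangentSpace 𝓘(ℝ, EM) x) (i : ι) :
    hX.coeff i x v = ε i * h x v (X i x) := by
  have hb : ∀ j, hX.toBasisAt hx j = X j x := hX.toBasisAt_coe hx
  have hc : hX.coeff i x v = (hX.toBasisAt hx).repr v i := by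
    simp only [IsLocalFrameOn.coeff, hx, dite_true]; rfl
  have key := bilin_eq_sum_of_orthogonal (h x).toLinearMap₁₂ (hX.toBasisAt hx) ε
    (fun j => by rw [hb]; exact hXdiag x hx j)
    (fun j k hjk => by rw [hb, hb]; exact hXoff x hx j k hjk) v (hX.toBasisAt hx i)
  have key' : h x v (X i x) = ε i * (hX.toBasisAt hx).repr v i := by
    rw [← hb i]
    refine key.trans ?_
    rw [Module.Basis.repr_self, Finset.sum_eq_single i]
    · simp
    · intro j _ hj
      simp [Finsupp.single_eq_of_ne hj]
    · intro hi
      exact absurd (Finset.mem_univ i) hi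
  rw [hc, key', ← mul_assoc]
  -- Here `ε i * ε i = 1`, which is why the sign may multiply instead of divide.
  rcases hε i with h1 | h1 <;> simp [h1]

theorem mainTheorem2
    {EM : Type*} [NormedAddCommGroup EM] [NormedSpace ℝ EM] [FiniteDimensional ℝ EM]
    {M : Type*} [TopologicalSpace M] [ChartedSpace EM M] [IsManifold 𝓘(ℝ, EM) ∞ M]
    {EG : Type*} [NormedAddCommGroup EG] [NormedSpace ℝ EG] [FiniteDimensional ℝ EG]
    {G : Type*} [TopologicalSpace G] [ChartedSpace EG G] [Group G] [LieGroup 𝓘(ℝ, EG) ∞ G]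
    [CompactSpace G]
    {EP : Type*} [NormedAddCommGroup EP] [NormedSpace ℝ EP] [FiniteDimensional ℝ EP]
    {P : Type*} [TopologicalSpace P] [ChartedSpace EP P] [IsManifold 𝓘(ℝ, EP) ∞ P]
    [MulAction G P] [ContMDiffSMul 𝓘(ℝ, EG) 𝓘(ℝ, EP) ∞ G P]
    -- the principal bundle, the metric of the base, the connection, the inner product on `𝔤`
    (pr : P → M) (hpr : IsPrincipalBundle EG G EP EM pr)
    (h : PseudoRiemannianMetric EM M)
    (conn : ∀ p : P, TangentSpace 𝓘(ℝ, EP) p →L[ℝ] GroupLieAlgebra 𝓘(ℝ, EG) G)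
    (hconn : IsConnectionForm conn)
    (K : GroupLieAlgebra 𝓘(ℝ, EG) G →L[ℝ] GroupLieAlgebra 𝓘(ℝ, EG) G →L[ℝ] ℝ)
    (hK : IsAdInvariantInner K)
    -- an orthonormal frame of the base over an open set and an orthonormal basis of `𝔤`
    {ι κ : Type*} [Fintype ι] [Fintype κ]
    (θ : Set M) (hθ : IsOpen θ)
    (X : ι → ∀ x : M, TangentSpace 𝓘(ℝ, EM) x)
    (hX : IsLocalFrameOn 𝓘(ℝ, EM) EM ∞ X θ)
    (ε : ι → ℝ) (hε : ∀ i, ε i = 1 ∨ ε i = -1)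
    (hXdiag : ∀ x ∈ θ, ∀ i, h.inner x (X i x) (X i x) = ε i)
    (hXoff : ∀ x ∈ θ, ∀ i j, i ≠ j → h.inner x (X i x) (X j x) = 0)
    (b : Module.Basis κ ℝ (GroupLieAlgebra 𝓘(ℝ, EG) G))
    (hbdiag : ∀ σ, K (b σ) (b σ) = 1) (hboff : ∀ σ τ, σ ≠ τ → K (b σ) (b τ) = 0)
    -- a smooth curve in `P`
    (J : Set ℝ) (hJ : IsOpen J) (γ : ℝ → P) (hγ : ContMDiffOn 𝓘(ℝ, ℝ) 𝓘(ℝ, EP) ∞ γ J) :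
    (∀ t ∈ J, pr (γ t) ∈ θ → ∀ i : ι,
      hX.coeff i (pr (γ t)) (mfderiv 𝓘(ℝ, EP) 𝓘(ℝ, EM) pr (γ t)
          (acceleration (kaluzaKleinMetric h.inner K pr conn) γ t)) =
        hX.coeff i (pr (γ t)) (acceleration h.inner (fun s => pr (γ s)) t) -
          ε i * ∑ j : ι, ∑ σ : κ,
            hX.coeff j (pr (γ t)) (mfderiv 𝓘(ℝ, EP) 𝓘(ℝ, EM) pr (γ t) (velocity γ t)) *
              b.repr (conn (γ t) (velocity γ t)) σ * fieldStrength pr conn X b (γ t) σ i j) ∧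
    (IsGeodesicOn (kaluzaKleinMetric h.inner K pr conn) γ J →
      ∀ t ∈ J, ∀ v : TangentSpace 𝓘(ℝ, EM) (pr (γ t)),
        h.inner (pr (γ t)) (acceleration h.inner (fun s => pr (γ s)) t) v =
          lorentzCoforce K pr conn (γ t) (velocity γ t) v) := by
  have main := fun t (ht : t ∈ J) (v : EM) =>
    inner_mfderiv_acceleration_kaluzaKleinMetric hpr h hconn hK hJ hγ ht v
  refine ⟨fun t ht hxθ i => ?_, fun hgeo t ht v => ?_⟩
  -- Both coefficients are `ε i` times a pairing with `X i`, so the claim is `ε i` times the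
  -- identity `main` at `v = X i`.
  · rw [coeff_eq_of_orthonormal h.inner hX hε hXdiag hXoff hxθ,
      coeff_eq_of_orthonormal h.inner hX hε hXdiag hXoff hxθ,
      ← lorentzCoforce_eq_sum hpr hconn K b hbdiag hboff (γ t) (velocity γ t)
        (fun j => hX.coeff j (pr (γ t)) (mfderiv 𝓘(ℝ, EP) 𝓘(ℝ, EM) pr (γ t) (velocity γ t)))
        (hX.coeff_sum_eq (fun x => _) hxθ) i, ← mul_sub]
    exact congrArg (ε i * ·) (main t ht (X i (pr (γ t))))
  · have h1 := main t ht v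
    have h2 : (mfderiv 𝓘(ℝ, EP) 𝓘(ℝ, EM) pr (γ t)
        (acceleration (kaluzaKleinMetric h.inner K pr conn) γ t) : EM) = 0 :=
      (congrArg (fun z : EP => (mfderiv 𝓘(ℝ, EP) 𝓘(ℝ, EM) pr (γ t) z : EM)) (hgeo t ht)).trans
        (map_zero (mfderiv 𝓘(ℝ, EP) 𝓘(ℝ, EM) pr (γ t)))
    have h3 : h.inner (pr (γ t)) (mfderiv 𝓘(ℝ, EP) 𝓘(ℝ, EM) pr (γ t)
        (acceleration (kaluzaKleinMetric h.inner K pr conn) γ t)) v = 0 := by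
      refine (congrArg (fun z : EM => h.inner (pr (γ t)) z v) h2).trans ?_
      exact DFunLike.congr_fun (map_zero (h.inner (pr (γ t)))) v
    exact (sub_eq_zero.1 (h1.symm.trans h3))
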